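/- Let $d\ge 1$ and let $x_1,\dots,x_m\in[0,1]^d$ be any finite initial set of points ($m\ge 0$). Consider a sequence $(x_n)_{n\ge 1}$ in $[0,1]^d$, $x_n=(x_{n,1},\dots,x_{n,d})$, that starts with these $m$ points and in which every further point $x_N$, $N>m$, is chosen so that $$\sum_{n=1}^{N-1}\prod_{j=1}^{d}\left(1+\sum_{k=1}^{N}\frac{\cos\bigl(2\pi k(x_{N,j}-x_{n,j})\bigr)}{k}\right)\le N-1 .$$ Let $$D_N^*=\sup_{y\in[0,1]^d}\left|\frac{\#\{1\le n\le N:\ x_{n,i}\le y_i\ \text{for all}\ 1\le i\le d\}}{N}-\prod_{i=1}^{d}y_i\right|$$ be the star discrepancy of the first $N$ points. Then there is a constant $C>0$ that depends only on the initial set (and on $d$) such that every such sequence satisfies $$D_N^*\le C\,\frac{(\log N)^d}{\sqrt N}\qquad\text{for all } N\ge 2 .$$ -/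

import Mathlib

open Classical in
/-- The star discrepancy `D_N^*` of the points `x 1, …, x N` of the cube `[0,1]^d`: the supremum
over `y ∈ [0,1]^d` of `|#{1 ≤ n ≤ N : x_{n,i} ≤ y_i for all i} / N - ∏ i, y_i|`. Sequences are
indexed from `1`; the value `x 0` plays no role. -/
noncomputable def starDiscrepancy {d : ℕ} (x : ℕ → Fin d → ℝ) (N : ℕ) : ℝ :=
  ⨆ y : Set.Icc (0 : Fin d → ℝ) 1,
    |(((Finset.Icc 1 N).filter fun n => ∀ i, x n i ≤ y.1 i).card : ℝ) / (N : ℝ) - ∏ i, y.1 i|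

/-- The sum `∑_{n=1}^{N-1} ∏_{j=1}^{d} (1 + ∑_{k=1}^{N} cos (2πk (x_{N,j} - x_{n,j})) / k)`. -/
noncomputable def greedySum {d : ℕ} (x : ℕ → Fin d → ℝ) (N : ℕ) : ℝ :=
  ∑ n ∈ Finset.Ico 1 N, ∏ j : Fin d,
    (1 + ∑ k ∈ Finset.Icc 1 N, Real.cos (2 * Real.pi * (k : ℝ) * (x N j - x n j)) / (k : ℝ))

/-- `x 1, x 2, …` is a sequence in `[0,1]^d` that begins with the `m` given points
`a 0, …, a (m-1)` and whose further points `x N`, `N > m`, all obey the rule that the sum over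
the earlier points is at most `N - 1` (its mean value as a function of `x N`). -/
structure IsGreedySequence {d m : ℕ} (a : Fin m → Fin d → ℝ) (x : ℕ → Fin d → ℝ) : Prop where
  mem_cube : ∀ n : ℕ, 1 ≤ n → ∀ j, 0 ≤ x n j ∧ x n j ≤ 1
  initial : ∀ i : Fin m, x (i.val + 1) = a i
  rule : ∀ N : ℕ, m < N → greedySum x N ≤ (N : ℝ) - 1

/-! The rule bounds, at each step, the potential of a different kernel `∏ (1 + cosSum n)`, so it
does not directly bound the energy of any one kernel. The remedy is to fix, while the number of
points grows from `N` to `2N`, one positive definite product kernel `boxKernel` of resolution `ε = K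
/ N`, built from the one-dimensional `mixKernel`. Since `cosSum n` approximates `-log |1 -
e^{2πix}|` and `mixKernel` is a mixture of its Poisson regularisations, `mixKernel ≤ cosSum n + Q`
holds pointwise for all `n ≥ N` (`mixKernel_le_cosSum_add`, `exists_comparison_majorant`). Here `Q`
has mean `c = O(log N / N)`, and apart from its mean it is dominated, in the positive semidefinite
order, by a small multiple of `mixKernel`.

By the rule, a new point then adds to the energy excess `∑ (boxKernel - 1)` at most its diagonal
term, of order `(log N)^d`, and the error due to `Q`. The total error is `O(c M²)` plus a small
multiple of the energy excess itself, which is absorbed (`energyExcess_block_le`). Passing to the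
next dyadic block halves `ε`; this multiplies the excess by at most `q^{-d} ≤ 4/3`, thanks to the
self-similarity of the mixture. As `8/7 · 4/3 < 2`, induction over dyadic blocks gives an excess of
`O(M (log M)^d)` (`exists_energyExcess_le`).

An Erdős–Turán argument turns energy into discrepancy (`abs_count_sub_le`). Indicators of boxes are
replaced by products of smoothed sawtooth functions, whose square norm in the reproducing kernel
space is `O((log M)^d)`. The smoothing error is bounded by Poisson kernels centred on the faces of
the box, again controlled by the energy. Hence the counting error is `O(√((log M)^d · M (log M)^d))
= O(√M (log M)^d)`. -/

/-! ### The positive semidefinite order on kernels. -/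

/-- A real symmetric kernel on `ℕ` all of whose finite quadratic forms are nonnegative. -/
def IsPSDKernel (F : ℕ → ℕ → ℝ) : Prop :=
  (∀ m n, F m n = F n m) ∧
    ∀ (s : Finset ℕ) (c : ℕ → ℝ), 0 ≤ ∑ m ∈ s, ∑ n ∈ s, c m * c n * F m n

namespace IsPSDKernel

variable {F G F' G' : ℕ → ℕ → ℝ}

lemma iff_posSemidef : IsPSDKernel F ↔ (Matrix.of F).PosSemidef := by
  constructor
  · rintro ⟨h1, h2⟩
    refine ⟨?_, fun x => ?_⟩
    · ext m n
      simpa using h1 n m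
    · have := h2 x.support x
      refine this.trans_eq ?_
      unfold Finsupp.sum
      refine Finset.sum_congr rfl fun m _ => Finset.sum_congr rfl fun n _ => ?_
      simp only [star_trivial, Matrix.of_apply]
      ring
  · rintro ⟨h1, h2⟩
    refine ⟨fun m n => ?_, fun s c => ?_⟩
    · have := congrFun (congrFun h1 n) m
      simpa using this
    · have := h2 (Finsupp.indicator s fun m _ => c m)
      refine this.trans_eq ?_
      rw [Finsupp.sum_of_support_subset _ (Finsupp.support_indicator_subset _ _) _ (by simp)]
      refine Finset.sum_congr rfl fun m hm => ?_
      rw [Finsupp.sum_of_support_subset _ (Finsupp.support_indicator_subset _ _) _ (by simp)]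
      refine Finset.sum_congr rfl fun n hn => ?_
      simp only [star_trivial, Matrix.of_apply, Finsupp.indicator_apply, hm, hn, dif_pos]
      ring

lemma sum_nonneg (h : IsPSDKernel F) (s : Finset ℕ) : 0 ≤ ∑ m ∈ s, ∑ n ∈ s, F m n := by
  simpa using h.2 s 1

lemma congr (h : IsPSDKernel F) (e : ∀ m n, F m n = G m n) : IsPSDKernel G := by
  have : F = G := by ext m n; exact e m n
  exact this ▸ h

lemma add (hF : IsPSDKernel F) (hG : IsPSDKernel G) :
    IsPSDKernel (fun m n => F m n + G m n) := by
  refine ⟨fun m n => by simp only [hF.1 m n, hG.1 m n], fun s c => ?_⟩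
  have := add_nonneg (hF.2 s c) (hG.2 s c)
  simpa only [mul_add, Finset.sum_add_distrib] using this

lemma const_mul {a : ℝ} (ha : 0 ≤ a) (hF : IsPSDKernel F) :
    IsPSDKernel (fun m n => a * F m n) := by
  refine ⟨fun m n => by simp only [hF.1 m n], fun s c => ?_⟩
  have := mul_nonneg ha (hF.2 s c)
  simp only [Finset.mul_sum] at this
  refine this.trans_eq (Finset.sum_congr rfl fun m _ => Finset.sum_congr rfl fun n _ => by ring)

/-- The Schur product theorem. It allows one-dimensional comparisons to be multiplied over the
coordinates. -/
lemma mul (hF : IsPSDKernel F) (hG : IsPSDKernel G) :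
    IsPSDKernel (fun m n => F m n * G m n) := by
  rw [iff_posSemidef] at *
  exact hF.hadamard hG

lemma rankOne (f : ℕ → ℝ) : IsPSDKernel (fun m n => f m * f n) := by
  refine ⟨fun m n => mul_comm _ _, fun s c => ?_⟩
  have : ∑ m ∈ s, ∑ n ∈ s, c m * c n * (f m * f n) = (∑ m ∈ s, c m * f m) ^ 2 := by
    rw [sq, Finset.sum_mul_sum]
    exact Finset.sum_congr rfl fun m _ => Finset.sum_congr rfl fun n _ => by ring
  rw [this]
  positivity

lemma const {a : ℝ} (ha : 0 ≤ a) : IsPSDKernel (fun _ _ => a) :=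
  ((rankOne fun _ => 1).const_mul ha).congr fun _ _ => by ring

lemma sum {ι : Type*} (s : Finset ι) {F : ι → ℕ → ℕ → ℝ} (h : ∀ i ∈ s, IsPSDKernel (F i)) :
    IsPSDKernel (fun m n => ∑ i ∈ s, F i m n) := by
  classical
  induction s using Finset.induction_on with
  | empty => simpa using const le_rfl
  | insert a s ha ih =>
    simp only [Finset.sum_insert ha]
    exact (h a (by simp)).add (ih fun i hi => h i (by simp [hi]))

lemma prod {ι : Type*} (s : Finset ι) {F : ι → ℕ → ℕ → ℝ} (h : ∀ i ∈ s, IsPSDKernel (F i)) :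
    IsPSDKernel (fun m n => ∏ i ∈ s, F i m n) := by
  classical
  induction s using Finset.induction_on with
  | empty => simpa using const zero_le_one
  | insert a s ha ih =>
    simp only [Finset.prod_insert ha]
    exact (h a (by simp)).mul (ih fun i hi => h i (by simp [hi]))

lemma of_tendsto {F : ℕ → ℕ → ℕ → ℝ} (h : ∀ k, IsPSDKernel (F k))
    (hl : ∀ m n, Filter.Tendsto (fun k => F k m n) Filter.atTop (nhds (G m n))) :
    IsPSDKernel G := by
  refine ⟨fun m n => ?_, fun s c => ?_⟩
  · exact tendsto_nhds_unique ((hl m n).congr fun k => (h k).1 m n) (hl n m)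
  · refine ge_of_tendsto' (x := Filter.atTop) (f := fun k => ∑ m ∈ s, ∑ n ∈ s, c m * c n * F k m n)
      ?_ fun k => (h k).2 s c
    exact tendsto_finsetSum _ fun m _ => tendsto_finsetSum _ fun n _ => (hl m n).const_mul _

lemma of_hasSum {F : ℕ → ℕ → ℕ → ℝ} (h : ∀ k, IsPSDKernel (F k))
    (hl : ∀ m n, HasSum (fun k => F k m n) (G m n)) : IsPSDKernel G :=
  of_tendsto (fun K => sum (Finset.range K) fun k _ => h k) fun m n => (hl m n).tendsto_sum_nat

/-- Products of kernels are monotone for the positive semidefinite order. -/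
lemma mul_sub_mul (hF : IsPSDKernel F) (hG' : IsPSDKernel G')
    (h : IsPSDKernel (fun m n => F' m n - F m n)) (h' : IsPSDKernel (fun m n => G' m n - G m n)) :
    IsPSDKernel (fun m n => F' m n * G' m n - F m n * G m n) :=
  ((h.mul hG').add (hF.mul h')).congr fun _ _ => by ring

/-- A product of kernels `1 + H i` exceeds `1` by a positive semidefinite kernel. -/
lemma prod_one_add_sub_one {ι : Type*} (s : Finset ι) {H : ι → ℕ → ℕ → ℝ}
    (h : ∀ i ∈ s, IsPSDKernel (H i)) :
    IsPSDKernel (fun m n => ∏ i ∈ s, (1 + H i m n) - 1) := by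
  classical
  induction s using Finset.induction_on with
  | empty => simpa using const le_rfl
  | insert a s ha ih =>
    simp only [Finset.prod_insert ha]
    have ih' := ih fun i hi => h i (by simp [hi])
    have h1 := h a (by simp)
    exact ((h1.mul (prod s fun i hi => (const zero_le_one).add (h i (by simp [hi])))).add ih').congr
      fun _ _ => by ring

/-- If `H' i ≤ H i / q` with `0 < q ≤ 1`, then `∏ (1 + H' i) - 1 ≤ q^{-#s} (∏ (1 + H i) - 1)`. -/
lemma prod_one_add_rescale {ι : Type*} (s : Finset ι) {H H' : ι → ℕ → ℕ → ℝ} {q : ℝ}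
    (hq : 0 < q) (hq1 : q ≤ 1)
    (h : ∀ i ∈ s, IsPSDKernel (H i)) (h' : ∀ i ∈ s, IsPSDKernel (H' i))
    (hle : ∀ i ∈ s, IsPSDKernel (fun m n => q⁻¹ * H i m n - H' i m n)) :
    IsPSDKernel (fun m n => (q⁻¹) ^ s.card * (∏ i ∈ s, (1 + H i m n) - 1)
      - (∏ i ∈ s, (1 + H' i m n) - 1)) := by
  classical
  induction s using Finset.induction_on with
  | empty => simpa using const le_rfl
  | insert a s ha ih =>
    simp only [Finset.prod_insert ha, Finset.card_insert_of_notMem ha]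
    have hs : ∀ i ∈ s, IsPSDKernel (H i) := fun i hi => h i (by simp [hi])
    have ih' := ih hs (fun i hi => h' i (by simp [hi])) fun i hi => hle i (by simp [hi])
    have hq' : 1 ≤ q⁻¹ := (one_le_inv₀ hq).2 hq1
    have hqs : 1 ≤ (q⁻¹) ^ s.card := one_le_pow₀ hq'
    have hP : IsPSDKernel (fun m n => ∏ i ∈ s, (1 + H i m n)) :=
      prod s fun i hi => (const zero_le_one).add (hs i hi)
    have hP1 := prod_one_add_sub_one s hs
    have hPP : IsPSDKernel (fun m n => (q⁻¹) ^ s.card * ∏ i ∈ s, (1 + H i m n)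
        - ∏ i ∈ s, (1 + H' i m n)) :=
      (ih'.add (const (sub_nonneg.2 hqs))).congr fun _ _ => by ring
    have hmul := mul_sub_mul (h' a (by simp)) (hP.const_mul (zero_le_one.trans hqs))
      (hle a (by simp)) hPP
    -- The subtracted mean `1` is not rescaled by the factors, so the target also needs the surplus
    -- `q^{-#s} (q⁻¹ - 1) (∏ (1 + H i) - 1)`, which is nonnegative because `q ≤ 1`.
    have hP2 := hP1.const_mul (a := (q⁻¹) ^ s.card * (q⁻¹ - 1))
      (mul_nonneg (by positivity) (by linarith))
    exact ((hmul.add ih').add hP2).congr fun _ _ => by ring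

lemma sum_mono (h : IsPSDKernel (fun m n => G m n - F m n)) (s : Finset ℕ) :
    ∑ m ∈ s, ∑ n ∈ s, F m n ≤ ∑ m ∈ s, ∑ n ∈ s, G m n := by
  have := h.sum_nonneg s
  simp only [Finset.sum_sub_distrib] at this
  linarith

/-- The parallelogram identity: `2 f⊗f + 2 g⊗g - (f+g)⊗(f+g) = (f-g)⊗(f-g)`. -/
lemma add_mul_add_le {f g : ℕ → ℝ} {a b : ℝ}
    (hf : IsPSDKernel (fun m n => a * F m n - f m * f n))
    (hg : IsPSDKernel (fun m n => b * F m n - g m * g n)) :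
    IsPSDKernel (fun m n => 2 * (a + b) * F m n - (f m + g m) * (f n + g n)) :=
  (((hf.const_mul zero_le_two).add (hg.const_mul zero_le_two)).add
    (rankOne fun m => f m - g m)).congr fun _ _ => by ring

/-- The square of a sum is bounded by the energy of a kernel that dominates the rank one kernel. -/
lemma sq_sum_le {f : ℕ → ℝ} (h : IsPSDKernel (fun m n => F m n - f m * f n)) (s : Finset ℕ) :
    (∑ n ∈ s, f n) ^ 2 ≤ ∑ m ∈ s, ∑ n ∈ s, F m n := by
  refine le_trans (le_of_eq ?_) (h.sum_mono s)
  rw [sq, Finset.sum_mul_sum]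

lemma cos_sub (t : ℕ → ℝ) (κ : ℝ) : IsPSDKernel (fun m n => Real.cos (κ * (t m - t n))) :=
  ((rankOne fun m => Real.cos (κ * t m)).add (rankOne fun m => Real.sin (κ * t m))).congr
    fun _ _ => by rw [mul_sub, Real.cos_sub]

/-- A function of positive type, with respect to the differences of the points `t n`. -/
lemma of_hasSum_cos {a : ℕ → ℝ} (ha : ∀ k, 0 ≤ a k) {f : ℝ → ℝ}
    (hf : ∀ x, HasSum (fun k : ℕ => a k * Real.cos (2 * Real.pi * k * x)) (f x)) (t : ℕ → ℝ) :
    IsPSDKernel (fun m n => f (t m - t n)) :=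
  of_hasSum (F := fun k m n => a k * Real.cos (2 * Real.pi * k * (t m - t n)))
    (fun k => (cos_sub t _).const_mul (ha k)) fun _ _ => hf _

/-- If `f` has Fourier coefficients `a k ≥ 0`, then a function with coefficients `b k`,
`b k ^ 2 ≤ a k * ρ k`, lies in the reproducing kernel space of `f`, with square norm `∑ ρ k`. -/
lemma rankOne_le_of_hasSum {a b ρ : ℕ → ℝ} (ha : ∀ k, 0 ≤ a k) (hρ : ∀ k, 0 ≤ ρ k)
    (hb : ∀ k, b k ^ 2 ≤ a k * ρ k) {R : ℝ} (hR : HasSum ρ R) {f g : ℝ → ℝ}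
    (hf : ∀ x, HasSum (fun k : ℕ => a k * Real.cos (2 * Real.pi * k * x)) (f x)) (φ α : ℝ)
    (hg : ∀ x, HasSum (fun k : ℕ => b k * Real.cos (2 * Real.pi * k * x + φ)) (g x))
    (t : ℕ → ℝ) :
    IsPSDKernel (fun m n => R * f (t m - t n) - g (t m - α) * g (t n - α)) := by
  refine of_tendsto (F := fun K m n =>
    (∑ k ∈ Finset.range K, ρ k) * (∑ k ∈ Finset.range K, a k *
        Real.cos (2 * Real.pi * k * (t m - t n)))
      - (∑ k ∈ Finset.range K, b k * Real.cos (2 * Real.pi * k * (t m - α) + φ)) *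
        (∑ k ∈ Finset.range K, b k * Real.cos (2 * Real.pi * k * (t n - α) + φ)))
    (fun K => ?_) fun m n => ?_
  · refine ⟨fun m n => ?_, fun s c => ?_⟩
    · dsimp only
      rw [mul_comm (∑ k ∈ Finset.range K, b k * Real.cos (2 * Real.pi * k * (t n - α) + φ))]
      congr 2
      refine Finset.sum_congr rfl fun k _ => ?_
      rw [← Real.cos_neg]
      congr 2
      ring
    -- Here `v k` and `w` below are the real and imaginary parts of one exponential sum, so the
    -- `k`-th cosine form is `v k ^ 2 + w ^ 2`. The sine part is dropped and Cauchy–Schwarz is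
    -- applied to `∑ b k * v k`.
    · set v : ℕ → ℝ := fun k => ∑ m ∈ s, c m * Real.cos (2 * Real.pi * k * (t m - α) + φ) with hv
      have h1 : ∑ m ∈ s, ∑ n ∈ s, c m * c n *
          ((∑ k ∈ Finset.range K, b k * Real.cos (2 * Real.pi * k * (t m - α) + φ)) *
          (∑ k ∈ Finset.range K, b k * Real.cos (2 * Real.pi * k * (t n - α) + φ)))
          = (∑ k ∈ Finset.range K, b k * v k) ^ 2 := by
        have : ∑ k ∈ Finset.range K, b k * v k = ∑ m ∈ s, c m *
            (∑ k ∈ Finset.range K, b k * Real.cos (2 * Real.pi * k * (t m - α) + φ)) := by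
          simp only [hv, Finset.mul_sum]
          rw [Finset.sum_comm]
          exact Finset.sum_congr rfl fun m _ => Finset.sum_congr rfl fun n _ => by ring
        rw [this, sq, Finset.sum_mul_sum]
        exact Finset.sum_congr rfl fun m _ => Finset.sum_congr rfl fun n _ => by ring
      have h2 : ∑ k ∈ Finset.range K, a k * v k ^ 2 ≤ ∑ m ∈ s, ∑ n ∈ s, c m * c n *
          (∑ k ∈ Finset.range K, a k * Real.cos (2 * Real.pi * k * (t m - t n))) := by
        have : ∑ m ∈ s, ∑ n ∈ s, c m * c n *
          (∑ k ∈ Finset.range K, a k * Real.cos (2 * Real.pi * k * (t m - t n)))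
          = ∑ k ∈ Finset.range K, a k * (∑ m ∈ s, ∑ n ∈ s, c m * c n *
            Real.cos (2 * Real.pi * k * (t m - t n))) := by
          simp only [Finset.mul_sum]
          rw [Finset.sum_comm (s := Finset.range K)]
          refine Finset.sum_congr rfl fun m _ => ?_
          rw [Finset.sum_comm (s := Finset.range K)]
          exact Finset.sum_congr rfl fun n _ => Finset.sum_congr rfl fun k _ => by ring
        rw [this]
        refine Finset.sum_le_sum fun k _ => mul_le_mul_of_nonneg_left ?_ (ha k)
        set w := ∑ m ∈ s, c m * Real.sin (2 * Real.pi * k * (t m - α) + φ) with hw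
        have : ∑ m ∈ s, ∑ n ∈ s, c m * c n * Real.cos (2 * Real.pi * k * (t m - t n))
            = v k ^ 2 + w ^ 2 := by
          rw [sq, sq, hv, hw, Finset.sum_mul_sum, Finset.sum_mul_sum, ← Finset.sum_add_distrib]
          refine Finset.sum_congr rfl fun m _ => ?_
          rw [← Finset.sum_add_distrib]
          refine Finset.sum_congr rfl fun n _ => ?_
          have : 2 * Real.pi * k * (t m - t n) = (2 * Real.pi * k * (t m - α) + φ)
            - (2 * Real.pi * k * (t n - α) + φ) := by ring
          rw [this, Real.cos_sub]
          ring
        rw [this]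
        nlinarith [sq_nonneg w]
      have h3 : (∑ k ∈ Finset.range K, b k * v k) ^ 2 ≤
          (∑ k ∈ Finset.range K, ρ k) * ∑ k ∈ Finset.range K, a k * v k ^ 2 :=
        Finset.sum_sq_le_sum_mul_sum_of_sq_le_mul _ (fun k _ => hρ k)
          (fun k _ => mul_nonneg (ha k) (sq_nonneg _))
          fun k _ => by nlinarith [mul_le_mul_of_nonneg_right (hb k) (sq_nonneg (v k))]
      have h4 := mul_le_mul_of_nonneg_left h2
        (Finset.sum_nonneg fun k (_ : k ∈ Finset.range K) => hρ k)
      have h5 : ∑ m ∈ s, ∑ n ∈ s, c m * c n * ((∑ k ∈ Finset.range K, ρ k) *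
          (∑ k ∈ Finset.range K, a k * Real.cos (2 * Real.pi * k * (t m - t n))))
          = (∑ k ∈ Finset.range K, ρ k) * ∑ m ∈ s, ∑ n ∈ s, c m * c n *
            (∑ k ∈ Finset.range K, a k * Real.cos (2 * Real.pi * k * (t m - t n))) := by
        rw [Finset.mul_sum]
        refine Finset.sum_congr rfl fun m _ => ?_
        rw [Finset.mul_sum]
        exact Finset.sum_congr rfl fun n _ => by ring
      dsimp only
      rw [Finset.sum_congr rfl fun m _ => Finset.sum_congr rfl fun n _ => mul_sub _ _ _]
      simp only [Finset.sum_sub_distrib]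
      rw [h1, h5]
      linarith
  · exact (hR.tendsto_sum_nat.mul (hf _).tendsto_sum_nat).sub
      ((hg _).tendsto_sum_nat.mul (hg _).tendsto_sum_nat)

end IsPSDKernel

/-! ### The logarithmic and Poisson kernels and their Fourier series. -/

/-- `|1 - e^{2πix}|²`. -/
noncomputable def chordSq (x : ℝ) : ℝ := 2 - 2 * Real.cos (2 * Real.pi * x)

/-- `|1 - r e^{2πix}|²`. -/
noncomputable def poissonDen (r x : ℝ) : ℝ := (1 - r) ^ 2 + r * chordSq x

/-- `-log |1 - r e^{2πix}|`. -/
noncomputable def logKernel (r x : ℝ) : ℝ := -(Real.log (poissonDen r x) / 2)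

/-- The Poisson kernel of the unit disc at `r e^{2πix}`. -/
noncomputable def poissonKer (r x : ℝ) : ℝ := (1 - r ^ 2) / poissonDen r x

/-- The `n`-th partial sum `∑_{k=1}^n cos (2πkx) / k`. -/
noncomputable def cosSum (n : ℕ) (x : ℝ) : ℝ :=
  ∑ k ∈ Finset.Icc 1 n, Real.cos (2 * Real.pi * (k : ℝ) * x) / (k : ℝ)

/-- The point `r e^{2πix}`. -/
noncomputable def circlePt (r x : ℝ) : ℂ := r * Complex.exp ((2 * Real.pi * x : ℝ) * Complex.I)

lemma chordSq_nonneg (x : ℝ) : 0 ≤ chordSq x := by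
  unfold chordSq
  linarith [Real.cos_le_one (2 * Real.pi * x)]

lemma chordSq_le_four (x : ℝ) : chordSq x ≤ 4 := by
  unfold chordSq
  linarith [Real.neg_one_le_cos (2 * Real.pi * x)]

lemma poissonDen_pos {r : ℝ} (h0 : 0 ≤ r) (h1 : r < 1) (x : ℝ) : 0 < poissonDen r x := by
  have := mul_nonneg h0 (chordSq_nonneg x)
  have : 0 < (1 - r) ^ 2 := pow_pos (by linarith) 2
  unfold poissonDen
  linarith

lemma sq_le_poissonDen {r : ℝ} (h0 : 0 ≤ r) (x : ℝ) : (1 - r) ^ 2 ≤ poissonDen r x := by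
  have := mul_nonneg h0 (chordSq_nonneg x)
  unfold poissonDen
  linarith

lemma poissonDen_le_four {r : ℝ} (h0 : 0 ≤ r) (h1 : r ≤ 1) (x : ℝ) : poissonDen r x ≤ 4 := by
  have := mul_le_mul_of_nonneg_left (chordSq_le_four x) h0
  unfold poissonDen
  nlinarith

lemma circlePt_re (r x : ℝ) : (circlePt r x).re = r * Real.cos (2 * Real.pi * x) := by
  rw [circlePt, Complex.re_ofReal_mul, Complex.exp_ofReal_mul_I_re]

lemma circlePt_im (r x : ℝ) : (circlePt r x).im = r * Real.sin (2 * Real.pi * x) := by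
  rw [circlePt, Complex.im_ofReal_mul, Complex.exp_ofReal_mul_I_im]

lemma norm_circlePt {r : ℝ} (h0 : 0 ≤ r) (x : ℝ) : ‖circlePt r x‖ = r := by
  rw [circlePt, norm_mul, Complex.norm_exp_ofReal_mul_I, Complex.norm_real, Real.norm_of_nonneg h0,
    mul_one]

lemma circlePt_pow (r x : ℝ) (k : ℕ) : circlePt r x ^ k = circlePt (r ^ k) (k * x) := by
  rw [circlePt, circlePt, mul_pow, ← Complex.exp_nat_mul]
  push_cast
  ring_nf

lemma circlePt_pow_re (r x : ℝ) (k : ℕ) :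
    (circlePt r x ^ k).re = r ^ k * Real.cos (2 * Real.pi * k * x) := by
  rw [circlePt_pow, circlePt_re, mul_assoc (2 * Real.pi)]

lemma circlePt_pow_im (r x : ℝ) (k : ℕ) :
    (circlePt r x ^ k).im = r ^ k * Real.sin (2 * Real.pi * k * x) := by
  rw [circlePt_pow, circlePt_im, mul_assoc (2 * Real.pi)]

lemma norm_one_sub_circlePt_sq (r x : ℝ) : ‖1 - circlePt r x‖ ^ 2 = poissonDen r x := by
  rw [Complex.sq_norm, Complex.normSq_apply]
  simp only [Complex.sub_re, Complex.sub_im, Complex.one_re, Complex.one_im, circlePt_re,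
    circlePt_im, poissonDen, chordSq]
  linear_combination r ^ 2 * Real.sin_sq_add_cos_sq (2 * Real.pi * x)

lemma log_norm_one_sub_circlePt (r x : ℝ) :
    -Real.log ‖1 - circlePt r x‖ = logKernel r x := by
  rw [logKernel, ← norm_one_sub_circlePt_sq, Real.log_pow]
  push_cast
  ring

/-- Real part of the Taylor series of `-log (1 - z)`. The term `k = 0` is zero because division by
zero gives zero, so the kernel has mean zero. -/
lemma hasSum_logKernel {r : ℝ} (h0 : 0 ≤ r) (h1 : r < 1) (x : ℝ) :
    HasSum (fun k : ℕ => r ^ k / k * Real.cos (2 * Real.pi * k * x)) (logKernel r x) := by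
  have := Complex.hasSum_re
    (Complex.hasSum_taylorSeries_neg_log (z := circlePt r x) (by rwa [norm_circlePt h0]))
  rw [Complex.neg_re, Complex.log_re, log_norm_one_sub_circlePt] at this
  convert this using 2 with k
  rw [Complex.div_natCast_re, circlePt_pow_re]
  ring

lemma hasSum_arg {r : ℝ} (h0 : 0 ≤ r) (h1 : r < 1) (x : ℝ) :
    HasSum (fun k : ℕ => r ^ k / k * Real.sin (2 * Real.pi * k * x))
      (-Complex.arg (1 - circlePt r x)) := by
  have := Complex.hasSum_im
    (Complex.hasSum_taylorSeries_neg_log (z := circlePt r x) (by rwa [norm_circlePt h0]))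
  rw [Complex.neg_im, Complex.log_im] at this
  convert this using 2 with k
  rw [Complex.div_natCast_im, circlePt_pow_im]
  ring

lemma hasSum_geometric_circlePt {r : ℝ} (h0 : 0 ≤ r) (h1 : r < 1) (x : ℝ) :
    HasSum (fun k : ℕ => circlePt r x ^ k) (1 - circlePt r x)⁻¹ :=
  hasSum_geometric_of_norm_lt_one (by rwa [norm_circlePt h0])

lemma hasSum_poissonKer {r : ℝ} (h0 : 0 ≤ r) (h1 : r < 1) (x : ℝ) :
    HasSum (fun k : ℕ => (if k = 0 then 0 else 2 * r ^ k) * Real.cos (2 * Real.pi * k * x))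
      (poissonKer r x - 1) := by
  have h := (Complex.hasSum_re (hasSum_geometric_circlePt h0 h1 x)).mul_left 2
  have h2 := h.sub (hasSum_ite_eq (0 : ℕ) (2 : ℝ))
  have hd := poissonDen_pos h0 h1 x
  have ev : poissonKer r x - 1 = 2 * (1 - circlePt r x)⁻¹.re - 2 := by
    rw [Complex.inv_re, ← Complex.sq_norm, norm_one_sub_circlePt_sq, poissonKer, Complex.sub_re,
      circlePt_re, Complex.one_re]
    field_simp
    unfold poissonDen chordSq
    ring
  rw [ev]
  have ef : (fun k : ℕ => (if k = 0 then 0 else 2 * r ^ k) * Real.cos (2 * Real.pi * k * x))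
      = fun k => 2 * (circlePt r x ^ k).re - if k = 0 then 2 else 0 := by
    ext k
    rw [circlePt_pow_re]
    split_ifs with hk
    · subst hk; simp
    · ring
  rw [ef]
  exact h2

lemma hasSum_sin_geometric {r : ℝ} (h0 : 0 ≤ r) (h1 : r < 1) (x : ℝ) :
    HasSum (fun k : ℕ => r ^ k * Real.sin (2 * Real.pi * k * x))
      (circlePt r x / (1 - circlePt r x)).im := by
  have h := Complex.hasSum_im (hasSum_geometric_circlePt h0 h1 x)
  have hne : 1 - circlePt r x ≠ 0 := by
    intro h
    have := norm_one_sub_circlePt_sq r x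
    rw [h] at this
    have := poissonDen_pos h0 h1 x
    simp_all
  have : circlePt r x / (1 - circlePt r x) = (1 - circlePt r x)⁻¹ - 1 := by
    field_simp
    ring
  rw [this, Complex.sub_im, Complex.one_im, sub_zero]
  simpa only [circlePt_pow_im] using h

/-! ### Lower bounds for the truncated cosine sum. -/

/-- Summation by parts: the factor `1 - z` turns the sum into boundary terms and a sum of `z^{k+1}
(1/k - 1/(k+1))`, whose coefficients telescope. Keeping the upper boundary term on the left makes
the induction exact. -/
lemma norm_mul_sum_pow_div_le {z : ℂ} (hz : ‖z‖ ≤ 1) {n : ℕ} (hn : 1 ≤ n) (M : ℕ) :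
    ‖(1 - z) * ∑ k ∈ Finset.Ico n (n + M), z ^ k / k + z ^ (n + M) / (n + M : ℕ)‖
      ≤ 2 / n - 1 / (n + M : ℕ) := by
  have hn0 : (0 : ℝ) < n := by exact_mod_cast hn
  induction M with
  | zero =>
    simp only [add_zero, Finset.Ico_self, Finset.sum_empty, mul_zero, zero_add, norm_div, norm_pow,
      Complex.norm_natCast]
    have : ‖z‖ ^ n / n ≤ 1 / n := by gcongr; exact pow_le_one₀ (norm_nonneg _) hz
    calc _ ≤ _ := this
      _ = _ := by ring
  | succ M ih =>
    have hc : ((n + M : ℕ) : ℂ) ≠ 0 := by exact_mod_cast (by omega : n + M ≠ 0)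
    have hc' : ((n + (M + 1) : ℕ) : ℂ) ≠ 0 := by exact_mod_cast (by omega : n + (M + 1) ≠ 0)
    have e : (1 - z) * ∑ k ∈ Finset.Ico n (n + (M + 1)), z ^ k / k
        + z ^ (n + (M + 1)) / (n + (M + 1) : ℕ)
        = ((1 - z) * ∑ k ∈ Finset.Ico n (n + M), z ^ k / k + z ^ (n + M) / (n + M : ℕ))
          - z ^ (n + (M + 1)) * ((1 / (n + M : ℕ) - 1 / (n + (M + 1) : ℕ) : ℝ) : ℂ) := by
      rw [← add_assoc n M 1, Finset.sum_Ico_succ_top (by omega)]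
      push_cast at *
      ring
    have hlt : (0 : ℝ) ≤ 1 / (n + M : ℕ) - 1 / (n + (M + 1) : ℕ) := by
      rw [sub_nonneg]
      apply one_div_le_one_div_of_le
      · exact_mod_cast (by omega : 0 < n + M)
      · exact_mod_cast (by omega : n + M ≤ n + (M + 1))
    rw [e]
    refine (norm_sub_le _ _).trans ?_
    rw [norm_mul, norm_pow, Complex.norm_real, Real.norm_of_nonneg hlt]
    have := mul_le_of_le_one_left hlt (pow_le_one₀ (n := n + (M + 1)) (norm_nonneg _) hz)
    linarith

lemma norm_mul_norm_sum_pow_div_le {z : ℂ} (hz : ‖z‖ ≤ 1) {n : ℕ} (hn : 1 ≤ n) (M : ℕ) :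
    ‖1 - z‖ * ‖∑ k ∈ Finset.Ico n (n + M), z ^ k / k‖ ≤ 2 / n := by
  have h := norm_mul_sum_pow_div_le hz hn M
  have h2 : ‖z ^ (n + M) / (n + M : ℕ)‖ ≤ 1 / (n + M : ℕ) := by
    rw [norm_div, norm_pow, Complex.norm_natCast]
    gcongr
    exact pow_le_one₀ (norm_nonneg _) hz
  rw [← norm_mul]
  have h3 := norm_sub_le ((1 - z) * ∑ k ∈ Finset.Ico n (n + M), z ^ k / k
    + z ^ (n + M) / (n + M : ℕ)) (z ^ (n + M) / (n + M : ℕ))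
  rw [add_sub_cancel_right] at h3
  linarith

/-- Abel summation of the tail of `∑ r^k cos (2πkx) / k`. -/
lemma logKernel_le_sum_add {r : ℝ} (h0 : 0 ≤ r) (h1 : r < 1) (x : ℝ) (n : ℕ) :
    logKernel r x ≤ ∑ k ∈ Finset.range (n + 1), r ^ k / k * Real.cos (2 * Real.pi * k * x)
      + 2 / ((n + 1 : ℕ) * √(poissonDen r x)) := by
  refine le_of_tendsto' ((hasSum_logKernel h0 h1 x).tendsto_sum_nat.comp
    (Filter.tendsto_add_atTop_nat (n + 1))) fun M => ?_
  rw [Function.comp_apply, Finset.range_eq_Ico, Finset.range_eq_Ico,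
    ← Finset.sum_Ico_consecutive _ (Nat.zero_le (n + 1)) (by omega : n + 1 ≤ M + (n + 1))]
  gcongr
  have h := norm_mul_norm_sum_pow_div_le (z := circlePt r x) (by rw [norm_circlePt h0]; exact h1.le)
    (n := n + 1) (by omega) M
  have hs : √(poissonDen r x) = ‖1 - circlePt r x‖ := by
    rw [← norm_one_sub_circlePt_sq, Real.sqrt_sq (norm_nonneg _)]
  have hpos : 0 < √(poissonDen r x) := Real.sqrt_pos.2 (poissonDen_pos h0 h1 x)
  have hre : ∑ k ∈ Finset.Ico (n + 1) (M + (n + 1)), r ^ k / k * Real.cos (2 * Real.pi * k * x)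
      = (∑ k ∈ Finset.Ico (n + 1) (n + 1 + M), circlePt r x ^ k / k).re := by
    rw [Complex.re_sum, add_comm M]
    refine Finset.sum_congr rfl fun k _ => ?_
    rw [Complex.div_natCast_re, circlePt_pow_re]
    ring
  rw [hre]
  refine (Complex.re_le_norm _).trans ?_
  rw [← hs] at h
  rw [le_div_iff₀ (by positivity)]
  have hn : (0 : ℝ) < (n + 1 : ℕ) := by positivity
  rw [le_div_iff₀ hn] at h
  linarith

lemma cosSum_eq_range (n : ℕ) (x : ℝ) :
    cosSum n x = ∑ k ∈ Finset.range (n + 1), 1 ^ k / (k : ℝ) * Real.cos (2 * Real.pi * k * x) := by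
  rw [Finset.range_eq_Ico, Finset.sum_eq_sum_Ico_succ_bot (by omega), cosSum]
  simp only [Nat.cast_zero, div_zero, zero_mul, zero_add, one_pow]
  exact Finset.sum_congr rfl fun k _ => by ring

lemma neg_log_chordSq_le (n : ℕ) {x : ℝ} (hx : 0 < chordSq x) :
    -(Real.log (chordSq x) / 2) ≤ cosSum n x + 2 / ((n + 1 : ℕ) * √(chordSq x)) := by
  have hd : poissonDen 1 x = chordSq x := by simp [poissonDen]
  have hc : Continuous fun r => poissonDen r x := by unfold poissonDen; fun_prop
  have hs : 0 < √(chordSq x) := Real.sqrt_pos.2 hx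
  have t1 : Filter.Tendsto (fun r => logKernel r x) (nhdsWithin 1 (Set.Iio 1))
      (nhds (-(Real.log (chordSq x) / 2))) := by
    rw [← hd]
    refine (((hc.tendsto 1).log (by rw [hd]; exact hx.ne')).div_const 2).neg.mono_left
      nhdsWithin_le_nhds
  have t2 : Filter.Tendsto (fun r : ℝ => ∑ k ∈ Finset.range (n + 1), r ^ k / k *
        Real.cos (2 * Real.pi * k * x) + 2 / ((n + 1 : ℕ) * √(poissonDen r x)))
      (nhdsWithin 1 (Set.Iio 1)) (nhds (cosSum n x + 2 / ((n + 1 : ℕ) * √(chordSq x)))) := by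
    rw [cosSum_eq_range, ← hd]
    refine Filter.Tendsto.mono_left ?_ nhdsWithin_le_nhds
    refine Filter.Tendsto.add ?_ ?_
    · refine (Continuous.tendsto ?_ 1)
      fun_prop
    · refine Filter.Tendsto.div tendsto_const_nhds ((hc.tendsto 1).sqrt.const_mul _) ?_
      rw [hd]
      positivity
  refine le_of_tendsto_of_tendsto t1 t2 ?_
  filter_upwards [Ioo_mem_nhdsLT (zero_lt_one' ℝ)] with r hr
  exact logKernel_le_sum_add hr.1.le hr.2 x n

lemma abs_sin_nat_mul_le (k : ℕ) (a : ℝ) : |Real.sin (k * a)| ≤ k * |Real.sin a| := by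
  induction k with
  | zero => simp
  | succ k ih =>
    push_cast
    rw [add_mul, one_mul, Real.sin_add]
    refine (abs_add_le _ _).trans ?_
    rw [abs_mul, abs_mul]
    have h1 := mul_le_of_le_one_right (abs_nonneg (Real.sin (k * a))) (Real.abs_cos_le_one a)
    have h2 := mul_le_of_le_one_left (abs_nonneg (Real.sin a)) (Real.abs_cos_le_one (k * a))
    linarith

lemma one_sub_cos_nat_mul_le (k : ℕ) (x : ℝ) :
    1 - Real.cos (2 * Real.pi * k * x) ≤ k ^ 2 * chordSq x / 2 := by
  have h := pow_le_pow_left₀ (abs_nonneg _) (abs_sin_nat_mul_le k (Real.pi * x)) 2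
  rw [mul_pow, sq_abs, sq_abs, Real.sin_sq, Real.sin_sq, Real.cos_sq, Real.cos_sq] at h
  unfold chordSq
  have e1 : 2 * (k * (Real.pi * x)) = 2 * Real.pi * k * x := by ring
  have e2 : 2 * (Real.pi * x) = 2 * Real.pi * x := by ring
  rw [e1, e2] at h
  linarith

/-- Useful only at distance `O(1/n)` from the integers, where every cosine is close to `1` and the
sum is close to the harmonic sum. -/
lemma log_sub_le_cosSum (n : ℕ) (hn : 1 ≤ n) (x : ℝ) :
    Real.log n - n ^ 2 * chordSq x ≤ cosSum n x := by
  have h1 : ∀ k ∈ Finset.Icc 1 n, (k : ℝ)⁻¹ - n * chordSq x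
      ≤ Real.cos (2 * Real.pi * (k : ℝ) * x) / (k : ℝ) := by
    intro k hk
    rw [Finset.mem_Icc] at hk
    have hk0 : (0 : ℝ) < k := by exact_mod_cast hk.1
    have hkn : (k : ℝ) ≤ n := by exact_mod_cast hk.2
    rw [le_div_iff₀ hk0, sub_mul, inv_mul_cancel₀ hk0.ne']
    have := one_sub_cos_nat_mul_le k x
    have hc := chordSq_nonneg x
    nlinarith [mul_le_mul_of_nonneg_right hkn (mul_nonneg hk0.le hc), mul_nonneg hk0.le (mul_nonneg hk0.le hc)]
  have h2 := Finset.sum_le_sum h1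
  rw [Finset.sum_sub_distrib] at h2
  have h3 := log_add_one_le_harmonic n
  rw [harmonic_eq_sum_Icc] at h3
  push_cast at h3
  have h4 : Real.log n ≤ Real.log ((n : ℝ) + 1) :=
    Real.log_le_log (by exact_mod_cast hn) (by linarith)
  simp only [Finset.sum_const, Nat.card_Icc, nsmul_eq_mul] at h2
  simp only [add_tsub_cancel_right] at h2
  unfold cosSum
  nlinarith

/-! ### The sawtooth function and its smoothing. -/

/-- The sawtooth function `{x} - 1/2`. -/
noncomputable def sawtooth (x : ℝ) : ℝ := Int.fract x - 1 / 2

/-- A smoothed sawtooth, with Fourier series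
`-π⁻¹ ∑ r^k (1/k + (1-r)/r) sin (2πkx)`. -/
noncomputable def smoothSaw (r x : ℝ) : ℝ :=
  Real.pi⁻¹ * (Complex.arg (1 - circlePt r x)
    - (1 - r) / r * (circlePt r x / (1 - circlePt r x)).im)

lemma abs_sawtooth_le (x : ℝ) : |sawtooth x| ≤ 1 / 2 := by
  unfold sawtooth
  rw [abs_le]
  constructor <;> linarith [Int.fract_nonneg x, Int.fract_lt_one x]

lemma hasSum_smoothSaw {r : ℝ} (h0 : 0 ≤ r) (h1 : r < 1) (x : ℝ) :
    HasSum (fun k : ℕ => Real.pi⁻¹ * (r ^ k * (1 + k * ((1 - r) / r)) / k)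
      * Real.cos (2 * Real.pi * k * x + Real.pi / 2)) (smoothSaw r x) := by
  have h := ((hasSum_arg h0 h1 x).add ((hasSum_sin_geometric h0 h1 x).mul_left ((1 - r) / r))).mul_left
    (-Real.pi⁻¹)
  have e : smoothSaw r x = -Real.pi⁻¹ * (-Complex.arg (1 - circlePt r x)
    + (1 - r) / r * (circlePt r x / (1 - circlePt r x)).im) := by
    unfold smoothSaw; ring
  have ef : (fun k : ℕ => Real.pi⁻¹ * (r ^ k * (1 + k * ((1 - r) / r)) / k)
      * Real.cos (2 * Real.pi * k * x + Real.pi / 2)) = fun k : ℕ => -Real.pi⁻¹ *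
      (r ^ k / k * Real.sin (2 * Real.pi * k * x)
        + (1 - r) / r * (r ^ k * Real.sin (2 * Real.pi * k * x))) := by
    ext k
    rw [Real.cos_add_pi_div_two]
    rcases eq_or_ne k 0 with rfl | hk
    · simp
    · field_simp
  rw [e, ef]
  exact h

lemma chordSq_eq (x : ℝ) : chordSq x = (2 * Real.sin (Real.pi * x)) ^ 2 := by
  unfold chordSq
  rw [mul_assoc, Real.cos_two_mul, mul_pow, Real.sin_sq]
  ring

lemma circlePt_one_eq_fract (x : ℝ) : circlePt 1 x = circlePt 1 (Int.fract x) := by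
  apply Complex.ext
  · rw [circlePt_re, circlePt_re, ← Real.cos_sub_int_mul_two_pi _ ⌊x⌋, Int.fract]
    congr 2; ring
  · rw [circlePt_im, circlePt_im, ← Real.sin_sub_int_mul_two_pi _ ⌊x⌋, Int.fract]
    congr 2; ring

lemma arg_one_sub_circlePt_one {x : ℝ} (hx : Int.fract x ≠ 0) :
    Complex.arg (1 - circlePt 1 x) = Real.pi * sawtooth x := by
  rw [circlePt_one_eq_fract]
  have h0 : 0 < Int.fract x := lt_of_le_of_ne (Int.fract_nonneg x) hx.symm
  have h1 := Int.fract_lt_one x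
  unfold sawtooth
  set y := Int.fract x
  have hs : 0 < 2 * Real.sin (Real.pi * y) := by
    have := Real.sin_pos_of_pos_of_lt_pi (by positivity : 0 < Real.pi * y)
      (by nlinarith [Real.pi_pos])
    linarith
  have e : 1 - circlePt 1 y = ((2 * Real.sin (Real.pi * y) : ℝ) : ℂ) *
      (Complex.cos ((Real.pi * (y - 1 / 2) : ℝ) : ℂ)
        + Complex.sin ((Real.pi * (y - 1 / 2) : ℝ) : ℂ) * Complex.I) := by
    have hc : Real.cos (Real.pi * (y - 1 / 2)) = Real.sin (Real.pi * y) := by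
      rw [← Real.cos_pi_div_two_sub, ← Real.cos_neg]; congr 1; ring
    have hsn : Real.sin (Real.pi * (y - 1 / 2)) = -Real.cos (Real.pi * y) := by
      rw [← Real.sin_pi_div_two_sub, ← Real.sin_neg]; congr 1; ring
    rw [← Complex.ofReal_cos, ← Complex.ofReal_sin, hc, hsn]
    have e2 : 2 * Real.pi * y = 2 * (Real.pi * y) := by ring
    apply Complex.ext
    · rw [Complex.re_ofReal_mul, Complex.sub_re, circlePt_re, e2, Real.cos_two_mul, Real.cos_sq',
        Complex.add_re, Complex.ofReal_re, Complex.re_ofReal_mul, Complex.I_re, Complex.one_re]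
      ring
    · rw [Complex.im_ofReal_mul, Complex.sub_im, circlePt_im, e2, Real.sin_two_mul,
        Complex.add_im, Complex.ofReal_im, Complex.im_ofReal_mul, Complex.I_im, Complex.one_im]
      ring
  rw [e, Complex.arg_mul_cos_add_sin_mul_I hs]
  constructor <;> nlinarith [Real.pi_pos]

/-- The smoothed sawtooth approximates the sawtooth at distance `1 - r` from its jump. -/
lemma abs_sawtooth_sub_smoothSaw_le {r : ℝ} (h0 : 0 < r) (h1 : r < 1) (x : ℝ) :
    |sawtooth x - smoothSaw r x| ≤ 5 * ((1 - r) ^ 2 / poissonDen r x) := by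
  set z := circlePt r x with hz
  have hd := poissonDen_pos h0.le h1 x
  have hnorm : ‖1 - z‖ ^ 2 = poissonDen r x := norm_one_sub_circlePt_sq r x
  have hne : 1 - z ≠ 0 := by
    intro h; rw [h] at hnorm; simp at hnorm; exact hd.ne hnorm
  set s : ℂ := -(((1 - r) / r : ℝ) : ℂ) * (z / (1 - z)) with hs
  have hsn : ‖s‖ ^ 2 = (1 - r) ^ 2 / poissonDen r x := by
    rw [hs, norm_mul, norm_neg, Complex.norm_real,
      Real.norm_of_nonneg (div_nonneg (by linarith) h0.le), norm_div, hz, norm_circlePt h0.le, ← hz,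
      ← hnorm]
    have : ‖1 - z‖ ≠ 0 := norm_ne_zero_iff.2 hne
    field_simp
  have hsim : s.im = -((1 - r) / r * (z / (1 - z)).im) := by
    rw [hs, ← Complex.ofReal_neg, Complex.im_ofReal_mul]; ring
  have hsaw : smoothSaw r x = Real.pi⁻¹ * (Complex.arg (1 - z) + s.im) := by
    rw [smoothSaw, hsim]; ring
  have hzre : 0 < (1 - z).re := by
    rw [Complex.sub_re, Complex.one_re]
    have := (Complex.re_le_norm z).trans_eq (norm_circlePt h0.le x)
    linarith
  have harg1 : |Complex.arg (1 - z)| < Real.pi / 2 :=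
    Complex.abs_arg_lt_pi_div_two_iff.2 (Or.inl hzre)
  rw [← hsn]
  have hpi := Real.pi_gt_three
  have hpinv : Real.pi⁻¹ ≤ 1 / 3 := by
    rw [inv_eq_one_div]; exact one_div_le_one_div_of_le (by norm_num) hpi.le
  have hpinv0 : 0 < Real.pi⁻¹ := by positivity
  have hsa : |s.im| ≤ ‖s‖ := Complex.abs_im_le_norm s
  rcases le_or_gt ‖s‖ (1 / 2) with hs2 | hs2
  · have hfr : Int.fract x ≠ 0 := by
      intro hfr
      have hD : poissonDen r x = (1 - r) ^ 2 := by
        have : chordSq x = 0 := by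
          rw [Int.fract_eq_zero_iff] at hfr
          obtain ⟨k, hk⟩ := hfr
          rw [chordSq_eq, ← hk, mul_comm Real.pi, Real.sin_int_mul_pi]
          ring
        simp [poissonDen, this]
      rw [hD, div_self (pow_ne_zero 2 (by linarith))] at hsn
      nlinarith [norm_nonneg s]
    have hw : circlePt 1 x = z / r := by
      rw [hz, circlePt, circlePt]
      have : (r : ℂ) ≠ 0 := by exact_mod_cast h0.ne'
      field_simp
      simp
    -- The argument of the left side is `π` times the sawtooth, and `arg (1 - z) + Im s` is `π`
    -- times `smoothSaw`. The correction term in `smoothSaw` thus removes the first-order part of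
    -- `arg (1 + s)`, leaving an error `O(‖s‖²)`, which is of the size of a Poisson kernel.
    have hmul : 1 - circlePt 1 x = (1 - z) * (1 + s) := by
      rw [hw, hs]
      have : (r : ℂ) ≠ 0 := by exact_mod_cast h0.ne'
      push_cast
      field_simp
      ring
    have hsre : 0 < (1 + s).re := by
      rw [Complex.add_re, Complex.one_re]
      have := (abs_le.1 (Complex.abs_re_le_norm s)).1
      linarith
    have harg2 : |Complex.arg (1 + s)| < Real.pi / 2 :=
      Complex.abs_arg_lt_pi_div_two_iff.2 (Or.inl hsre)
    have hne2 : 1 + s ≠ 0 := by intro h; rw [h] at hsre; simp at hsre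
    have harg : Complex.arg (1 - circlePt 1 x) = Complex.arg (1 - z) + Complex.arg (1 + s) := by
      rw [hmul]
      refine Complex.arg_mul hne hne2 ⟨?_, ?_⟩ <;> linarith [abs_lt.1 harg1, abs_lt.1 harg2]
    have hlog := Complex.norm_log_one_add_sub_self_le (z := s) (by linarith)
    have him : |Complex.arg (1 + s) - s.im| ≤ ‖s‖ ^ 2 := by
      have h3 := Complex.abs_im_le_norm (Complex.log (1 + s) - s)
      rw [Complex.sub_im, Complex.log_im] at h3
      refine h3.trans (hlog.trans ?_)
      have : (1 - ‖s‖)⁻¹ ≤ 2 := by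
        rw [inv_le_comm₀ (by linarith) (by norm_num)]; linarith
      nlinarith [mul_le_mul_of_nonneg_left this (sq_nonneg ‖s‖)]
    have e : sawtooth x - smoothSaw r x = Real.pi⁻¹ * (Complex.arg (1 + s) - s.im) := by
      rw [hsaw]
      rw [arg_one_sub_circlePt_one hfr] at harg
      field_simp
      linarith
    rw [e, abs_mul, abs_of_pos hpinv0]
    nlinarith [mul_le_mul hpinv him (abs_nonneg _) (by norm_num), sq_nonneg ‖s‖]
  -- For `‖s‖ > 1/2` no cancellation is needed: both functions are bounded by `O(1 + ‖s‖) =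
  -- O(‖s‖²)`.
  · have h4 : |smoothSaw r x| ≤ 1 / 2 + ‖s‖ / 3 := by
      rw [hsaw, abs_mul, abs_of_pos hpinv0]
      have h5 : |Complex.arg (1 - z) + s.im| ≤ Real.pi / 2 + ‖s‖ :=
        (abs_add_le _ _).trans (add_le_add harg1.le hsa)
      calc _ ≤ Real.pi⁻¹ * (Real.pi / 2 + ‖s‖) := by gcongr
        _ = 1 / 2 + Real.pi⁻¹ * ‖s‖ := by field_simp
        _ ≤ _ := by nlinarith [norm_nonneg s]
    have h6 := abs_sub (sawtooth x) (smoothSaw r x)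
    have h7 := abs_sawtooth_le x
    nlinarith

/-! ### Pointwise bounds for the logarithmic kernel. -/

lemma logKernel_le_neg_log {r : ℝ} (h0 : 0 ≤ r) (h1 : r < 1) (x : ℝ) :
    logKernel r x ≤ -Real.log (1 - r) := by
  have h := Real.log_le_log (by have : 0 < 1 - r := by linarith
                                positivity) (sq_le_poissonDen h0 x)
  rw [Real.log_pow] at h
  push_cast at h
  unfold logKernel
  linarith

lemma neg_log_two_le_logKernel {r : ℝ} (h0 : 0 ≤ r) (h1 : r < 1) (x : ℝ) :
    -Real.log 2 ≤ logKernel r x := by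
  have h := Real.log_le_log (poissonDen_pos h0 h1 x) (poissonDen_le_four h0 h1.le x)
  have e : (4 : ℝ) = 2 ^ 2 := by norm_num
  rw [e, Real.log_pow] at h
  push_cast at h
  unfold logKernel
  linarith

lemma neg_log_one_sub_le {δ : ℝ} (h0 : 0 ≤ δ) (h : δ ≤ 1 / 2) : -Real.log (1 - δ) ≤ 2 * δ := by
  have h1 := Real.one_sub_inv_le_log_of_pos (by linarith : 0 < 1 - δ)
  have h2 : (1 - δ)⁻¹ ≤ 1 + 2 * δ := by
    rw [inv_le_iff_one_le_mul₀ (by linarith)]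
    nlinarith
  linarith

lemma logKernel_le_neg_log_chordSq {δ : ℝ} (h0 : 0 < δ) (h : δ ≤ 1 / 2) {x : ℝ}
    (hx : 0 < chordSq x) : logKernel (1 - δ) x ≤ -(Real.log (chordSq x) / 2) + δ := by
  have h1 : (1 - δ) * chordSq x ≤ poissonDen (1 - δ) x := by
    unfold poissonDen; nlinarith
  have h2 := Real.log_le_log (mul_pos (by linarith) hx) h1
  rw [Real.log_mul (by linarith) hx.ne'] at h2
  have := neg_log_one_sub_le h0.le h
  unfold logKernel
  linarith

/-- Within distance `δ` of the singularity the smoothing gains a constant, from `log (3/2) ≥ 1/3`.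
This gain later pays for the truncation error of `cosSum`. -/
lemma logKernel_le_of_chordSq_le {δ : ℝ} (h : δ ≤ 1 / 2) {x : ℝ}
    (hx : 0 < chordSq x) (hxd : chordSq x ≤ δ ^ 2) :
    logKernel (1 - δ) x ≤ -(Real.log (chordSq x) / 2) - 1 / 6 := by
  have h1 : 3 / 2 * chordSq x ≤ poissonDen (1 - δ) x := by
    unfold poissonDen; nlinarith
  have h2 := Real.log_le_log (by positivity) h1
  rw [Real.log_mul (by norm_num) hx.ne'] at h2
  have := Real.one_sub_inv_le_log_of_pos (by norm_num : (0 : ℝ) < 3 / 2)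
  norm_num at this
  unfold logKernel
  linarith

/-- Beyond distance `δ` the gain decays quadratically; it comes from `log (1 + u) ≥ u / 2` with `u =
δ² / chordSq x ≤ 1`. -/
lemma logKernel_le_of_le_chordSq {δ : ℝ} (h0 : 0 < δ) (h : δ ≤ 1 / 2) {x : ℝ}
    (hxd : δ ^ 2 ≤ chordSq x) :
    logKernel (1 - δ) x ≤ -(Real.log (chordSq x) / 2) + δ - δ ^ 2 / (4 * chordSq x) := by
  have hx : 0 < chordSq x := lt_of_lt_of_le (by positivity) hxd
  set D := chordSq x with hD
  have h1 : (1 - δ) * (D * (1 + δ ^ 2 / D)) ≤ poissonDen (1 - δ) x := by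
    have : D * (1 + δ ^ 2 / D) = D + δ ^ 2 := by field_simp
    rw [this, poissonDen, ← hD]
    nlinarith [mul_pos h0 (pow_pos h0 2)]
  have hpos : 0 < 1 + δ ^ 2 / D := by positivity
  have h2 := Real.log_le_log (mul_pos (by linarith) (mul_pos hx hpos)) h1
  rw [Real.log_mul (by linarith) (by positivity), Real.log_mul hx.ne' hpos.ne'] at h2
  have h3 := neg_log_one_sub_le h0.le h
  have h4 := Real.one_sub_inv_le_log_of_pos hpos
  have hu : δ ^ 2 / D ≤ 1 := (div_le_one hx).2 hxd
  have hu0 : 0 < δ ^ 2 / D := by positivity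
  have h5 : (1 + δ ^ 2 / D)⁻¹ ≤ 1 - δ ^ 2 / D / 2 := by
    rw [inv_le_iff_one_le_mul₀ hpos]
    nlinarith
  have h6 : δ ^ 2 / (4 * D) = δ ^ 2 / D / 4 := by field_simp
  rw [h6]
  unfold logKernel
  linarith

lemma isPSDKernel_logKernel {r : ℝ} (h0 : 0 ≤ r) (h1 : r < 1) (t : ℕ → ℝ) :
    IsPSDKernel (fun m n => logKernel r (t m - t n)) :=
  IsPSDKernel.of_hasSum_cos (fun k => by positivity) (hasSum_logKernel h0 h1) t

/-! ### The self-similar mixture of logarithmic kernels. -/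

/-- A geometric mixture of the kernels `logKernel (1 - ε / 2 ^ i)`. Its Fourier coefficients
decay polynomially beyond `1 / ε`. -/
noncomputable def mixKernel (q ε x : ℝ) : ℝ :=
  ∑' i : ℕ, (1 - q) * q ^ i * logKernel (1 - ε / 2 ^ i) x

section mix

variable {q ε : ℝ}

lemma div_two_pow_pos (hε : 0 < ε) (i : ℕ) : 0 < ε / 2 ^ i := by positivity

lemma div_two_pow_le (hε : 0 < ε) (i : ℕ) : ε / 2 ^ i ≤ ε :=
  div_le_self hε.le (one_le_pow₀ one_le_two)

lemma hasSum_mix_weights (hq : 0 < q) (hq1 : q < 1) :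
    HasSum (fun i : ℕ => (1 - q) * q ^ i) 1 := by
  have := (hasSum_geometric_of_lt_one hq.le hq1).mul_left (1 - q)
  rwa [mul_inv_cancel₀ (by linarith)] at this

lemma hasSum_mix_log_bound (hq : 0 < q) (hq1 : q < 1) (ε : ℝ) :
    HasSum (fun i : ℕ => (1 - q) * q ^ i * (-Real.log ε + i * Real.log 2))
      (-Real.log ε + Real.log 2 * (q / (1 - q))) := by
  have h1 := (hasSum_mix_weights hq hq1).mul_right (-Real.log ε)
  have h2 := (hasSum_coe_mul_geometric_of_norm_lt_one (r := q)
    (by rwa [Real.norm_of_nonneg hq.le])).mul_left ((1 - q) * Real.log 2)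
  have h3 := h1.add h2
  have hne : 1 - q ≠ 0 := by linarith
  have ef : (fun i : ℕ => (1 - q) * q ^ i * (-Real.log ε + i * Real.log 2)) = fun i : ℕ =>
      (1 - q) * q ^ i * (-Real.log ε) + (1 - q) * Real.log 2 * (i * q ^ i) := by
    ext i; ring
  have ev : -Real.log ε + Real.log 2 * (q / (1 - q))
      = 1 * (-Real.log ε) + (1 - q) * Real.log 2 * (q / (1 - q) ^ 2) := by
    field_simp
  rw [ef, ev]
  exact h3

lemma logKernel_scale_le (hε : 0 < ε) (hε1 : ε ≤ 1) (i : ℕ) (x : ℝ) :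
    logKernel (1 - ε / 2 ^ i) x ≤ -Real.log ε + i * Real.log 2 := by
  have h1 := div_two_pow_pos hε i
  have h2 := div_two_pow_le hε i
  have := logKernel_le_neg_log (r := 1 - ε / 2 ^ i) (by linarith) (by linarith) x
  rw [sub_sub_cancel, Real.log_div hε.ne' (by positivity), Real.log_pow] at this
  linarith

lemma neg_log_two_le_scale (hε : 0 < ε) (hε1 : ε ≤ 1) (i : ℕ) (x : ℝ) :
    -Real.log 2 ≤ logKernel (1 - ε / 2 ^ i) x := by
  have h1 := div_two_pow_pos hε i
  have h2 := div_two_pow_le hε i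
  exact neg_log_two_le_logKernel (by linarith) (by linarith) x

lemma summable_mixKernel (hq : 0 < q) (hq1 : q < 1) (hε : 0 < ε) (hε1 : ε ≤ 1) (x : ℝ) :
    Summable (fun i : ℕ => (1 - q) * q ^ i * logKernel (1 - ε / 2 ^ i) x) := by
  have hw : ∀ i : ℕ, 0 ≤ (1 - q) * q ^ i := fun i => mul_nonneg (by linarith) (by positivity)
  have h1 := ((hasSum_mix_weights hq hq1).mul_right (Real.log 2)).summable
  have h2 : Summable (fun i : ℕ => (1 - q) * q ^ i * (logKernel (1 - ε / 2 ^ i) x + Real.log 2)) := by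
    refine Summable.of_nonneg_of_le
      (fun i => mul_nonneg (hw i) (by linarith [neg_log_two_le_scale hε hε1 i x]))
      (fun i => mul_le_mul_of_nonneg_left
        (add_le_add_left (logKernel_scale_le hε hε1 i x) (Real.log 2)) (hw i)) ?_
    simp only [mul_add _ _ (Real.log 2)]
    exact (hasSum_mix_log_bound hq hq1 ε).summable.add h1
  refine (h2.sub h1).congr fun i => ?_
  ring

lemma mixKernel_le_of_forall (hq : 0 < q) (hq1 : q < 1) (hε : 0 < ε) (hε1 : ε ≤ 1) {x B : ℝ}
    (h : ∀ i : ℕ, logKernel (1 - ε / 2 ^ i) x ≤ B) : mixKernel q ε x ≤ B := by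
  have h1 := (hasSum_mix_weights hq hq1).mul_right B
  rw [one_mul] at h1
  exact hasSum_le (fun i => mul_le_mul_of_nonneg_left (h i)
    (mul_nonneg (by linarith) (by positivity))) (summable_mixKernel hq hq1 hε hε1 x).hasSum h1

lemma neg_log_two_le_mixKernel (hq : 0 < q) (hq1 : q < 1) (hε : 0 < ε) (hε1 : ε ≤ 1) (x : ℝ) :
    -Real.log 2 ≤ mixKernel q ε x := by
  have h1 := (hasSum_mix_weights hq hq1).mul_right (-Real.log 2)
  rw [one_mul] at h1
  exact hasSum_le (fun i => mul_le_mul_of_nonneg_left (neg_log_two_le_scale hε hε1 i x)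
    (mul_nonneg (by linarith) (by positivity))) h1 (summable_mixKernel hq hq1 hε hε1 x).hasSum

lemma mixKernel_le_neg_log (hq : 0 < q) (hq1 : q < 1) (hε : 0 < ε) (hε1 : ε ≤ 1) (x : ℝ) :
    mixKernel q ε x ≤ -Real.log ε + 1 / (1 - q) := by
  have h1 : mixKernel q ε x ≤ _ := hasSum_le (fun i => mul_le_mul_of_nonneg_left
    (logKernel_scale_le hε hε1 i x) (mul_nonneg (by linarith) (by positivity)))
    (summable_mixKernel hq hq1 hε hε1 x).hasSum (hasSum_mix_log_bound hq hq1 ε)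
  have h2 : Real.log 2 * (q / (1 - q)) ≤ 1 / (1 - q) := by
    rw [mul_div_assoc']
    have hp : 0 < 1 - q := by linarith
    gcongr
    have := Real.log_two_lt_d9
    have := Real.log_pos one_lt_two
    nlinarith
  linarith

lemma mixKernel_eq (hq : 0 < q) (hq1 : q < 1) (hε : 0 < ε) (hε1 : ε ≤ 1) (x : ℝ) :
    mixKernel q ε x = (1 - q) * logKernel (1 - ε) x + q * mixKernel q (ε / 2) x := by
  unfold mixKernel
  rw [(summable_mixKernel hq hq1 hε hε1 x).tsum_eq_zero_add, ← tsum_mul_left]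
  simp only [pow_zero, mul_one, div_one]
  congr 1
  refine tsum_congr fun i => ?_
  rw [pow_succ, pow_succ, mul_comm ((2 : ℝ) ^ i) 2, ← div_div]
  ring

lemma isPSDKernel_mixKernel (hq : 0 < q) (hq1 : q < 1) (hε : 0 < ε) (hε1 : ε ≤ 1) (t : ℕ → ℝ) :
    IsPSDKernel (fun m n => mixKernel q ε (t m - t n)) := by
  refine IsPSDKernel.of_hasSum (fun i => (isPSDKernel_logKernel (r := 1 - ε / 2 ^ i) ?_ ?_
    t).const_mul (a := (1 - q) * q ^ i) (mul_nonneg (by linarith) (by positivity)))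
    fun m n => (summable_mixKernel hq hq1 hε hε1 _).hasSum
  · linarith [div_two_pow_le hε i]
  · linarith [div_two_pow_pos hε i]

/-- This is the reason for the mixture: halving the scale costs only a factor `q⁻¹`, as close to `1`
as desired. For a single `logKernel (1 - ε)` no constant works, because its coefficients decay
exponentially at a rate depending on `ε`. -/
lemma mixKernel_half_le (hq : 0 < q) (hq1 : q < 1) (hε : 0 < ε) (hε1 : ε ≤ 1) (t : ℕ → ℝ) :
    IsPSDKernel (fun m n => q⁻¹ * mixKernel q ε (t m - t n) - mixKernel q (ε / 2) (t m - t n)) := by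
  refine ((isPSDKernel_logKernel (r := 1 - ε) (by linarith) (by linarith) t).const_mul
    (a := q⁻¹ * (1 - q)) (mul_nonneg (by positivity) (by linarith))).congr fun m n => ?_
  rw [mixKernel_eq hq hq1 hε hε1]
  field_simp
  ring

lemma logKernel_le_mixKernel (hq : 0 < q) (hq1 : q < 1) (hε : 0 < ε) (hε1 : ε ≤ 1) (t : ℕ → ℝ) :
    IsPSDKernel (fun m n =>
      mixKernel q ε (t m - t n) - (1 - q) * logKernel (1 - ε) (t m - t n)) := by
  refine ((isPSDKernel_mixKernel hq hq1 (half_pos hε) (by linarith) t).const_mul hq.le).congr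
    fun m n => ?_
  rw [mixKernel_eq hq hq1 hε hε1]
  ring

/-- Only the coarsest component, of weight `1 - q`, is used for the gain `c`; the finer ones satisfy
the bound without gain. -/
lemma mixKernel_le_of_logKernel (hq : 0 < q) (hq1 : q < 1) (hε : 0 < ε) (hε1 : ε ≤ 1 / 2) {x c : ℝ}
    (hx : 0 < chordSq x)
    (h : logKernel (1 - ε) x ≤ -(Real.log (chordSq x) / 2) + ε - c) :
    mixKernel q ε x ≤ -(Real.log (chordSq x) / 2) + ε - (1 - q) * c := by
  rw [mixKernel_eq hq hq1 hε (by linarith)]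
  have h2 : mixKernel q (ε / 2) x ≤ -(Real.log (chordSq x) / 2) + ε := by
    refine mixKernel_le_of_forall hq hq1 (half_pos hε) (by linarith) fun i => ?_
    have h3 := div_two_pow_pos (half_pos hε) i
    have h4 := div_two_pow_le (half_pos hε) i
    have := logKernel_le_neg_log_chordSq h3 (by linarith) hx
    linarith
  nlinarith [mul_le_mul_of_nonneg_left h (by linarith : 0 ≤ 1 - q),
    mul_le_mul_of_nonneg_left h2 hq.le]

end mix

/-! ### Pointwise comparison of the mixture with the truncated sum. -/

section comparison

variable {q K : ℝ} {N n : ℕ}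

lemma comparison_const_bounds (hq : 0 < q) (hq1 : q < 1)
    (hK : (16 / (1 - q)) ^ 2 + 1 / (1 - q) ≤ Real.log K) (hK0 : 0 < K) :
    256 ≤ (1 - q) ^ 2 * K := by
  have hp : 0 < 1 - q := by linarith
  have h1 := Real.log_le_sub_one_of_pos hK0
  have h2 : 0 < 1 / (1 - q) := by positivity
  have h3 : (16 / (1 - q)) ^ 2 ≤ K := by linarith
  rw [div_pow, div_le_iff₀ (by positivity)] at h3
  linarith

/-- Close to the diagonal the mixed kernel is at most the truncated one. -/
lemma mixKernel_le_cosSum_of_near (hq : 0 < q) (hq1 : q < 1) (hK0 : 0 < K)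
    (hK : (16 / (1 - q)) ^ 2 + 1 / (1 - q) ≤ Real.log K)
    (hKN : K ≤ N) (hn : N ≤ n) {x : ℝ} (hx : √(chordSq x) * n ≤ 16 / (1 - q)) :
    mixKernel q (K / N) x ≤ cosSum n x := by
  have hN : (0 : ℝ) < N := hK0.trans_le hKN
  have hN' : 0 < N := by exact_mod_cast hN
  have hnN : (N : ℝ) ≤ n := by exact_mod_cast hn
  have h1 := mixKernel_le_neg_log hq hq1 (by positivity : 0 < K / N) ((div_le_one hN).2 hKN) x
  have h2 := log_sub_le_cosSum n (by omega) x
  rw [Real.log_div hK0.ne' hN.ne'] at h1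
  have h3 := Real.log_le_log hN hnN
  have h4 := pow_le_pow_left₀ (by positivity) hx 2
  rw [mul_pow, Real.sq_sqrt (chordSq_nonneg x)] at h4
  linarith

lemma mixKernel_le_cosSum_add (hq : 0 < q) (hq1 : q < 1) (hK0 : 0 < K)
    (hK : (16 / (1 - q)) ^ 2 + 1 / (1 - q) ≤ Real.log K)
    (hKN : 2 * K ≤ N) (hn : N ≤ n) {x : ℝ} :
    (√(chordSq x) ≤ (1 - q) * (K / N) * K / 8 → mixKernel q (K / N) x ≤ cosSum n x + K / N) ∧
    ((1 - q) * (K / N) * K / 8 < √(chordSq x) →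
      mixKernel q (K / N) x ≤ cosSum n x + K / N + 2 / (N * √(chordSq x))) := by
  have hN : (0 : ℝ) < N := by linarith
  have hnN : (N : ℝ) ≤ n := by exact_mod_cast hn
  have hp : 0 < 1 - q := by linarith
  set s := √(chordSq x) with hs
  set ε := K / N with hε
  have hε0 : 0 < ε := by positivity
  have hε1 : ε ≤ 1 / 2 := by rw [hε, div_le_iff₀ hN]; linarith
  have hs0 : 0 ≤ s := Real.sqrt_nonneg _
  rcases le_or_gt (s * n) (16 / (1 - q)) with h | h
  · have := mixKernel_le_cosSum_of_near hq hq1 hK0 hK (by linarith) hn h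
    refine ⟨fun _ => by linarith, fun _ => ?_⟩
    have : 0 ≤ 2 / (N * s) := by positivity
    linarith
  · have hsn : 0 < s * n := lt_trans (by positivity) h
    have hspos : 0 < s := by
      rcases hs0.lt_or_eq with h' | h'
      · exact h'
      · rw [← h'] at hsn; simp at hsn
    have hD : 0 < chordSq x := Real.sqrt_pos.1 hspos
    have hD2 : s ^ 2 = chordSq x := Real.sq_sqrt hD.le
    have hg := neg_log_chordSq_le n hD
    have hg2 : 2 / ((n + 1 : ℕ) * s) ≤ 2 / (n * s) := by
      apply div_le_div_of_nonneg_left (by norm_num) (by linarith)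
      push_cast
      nlinarith
    have hg3 : 2 / (n * s) ≤ 2 / (N * s) :=
      div_le_div_of_nonneg_left (by norm_num) (by positivity)
        (mul_le_mul_of_nonneg_right hnN hs0)
    refine ⟨fun hτ => ?_, fun hτ => ?_⟩
    -- Intermediate distances: the truncation error `2 / (n s)` is covered by the smoothing gain.
    -- The threshold `(1 - q) ε K / 8` is exactly where the gain `(1 - q) ε² / (4 s²)` equals `2 /
    -- (N s)`, since `N ε = K`.
    · rcases le_or_gt s ε with hsε | hsε
      · have h1 := logKernel_le_of_chordSq_le hε1 hD (by rw [← hD2]; gcongr)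
        have h2 := mixKernel_le_of_logKernel hq hq1 hε0 hε1 hD (c := 1 / 6) (by linarith)
        have h3 : 2 / (n * s) ≤ (1 - q) / 8 := by
          rw [div_lt_iff₀ hp] at h
          rw [div_le_iff₀ (by linarith)]
          linarith
        linarith
      · have h1 := logKernel_le_of_le_chordSq hε0 hε1 (x := x) (by rw [← hD2]; gcongr)
        have h2 := mixKernel_le_of_logKernel hq hq1 hε0 hε1 hD h1
        have h3 : 2 / (N * s) ≤ (1 - q) * (ε ^ 2 / (4 * chordSq x)) := by
          have hNε : (N : ℝ) = K / ε := by rw [hε]; field_simp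
          rw [← hD2, hNε, mul_div_assoc', div_le_div_iff₀ (by positivity) (by positivity)]
          have : 2 * (4 * s ^ 2) * 1 ≤ (1 - q) * ε * K * s := by nlinarith
          field_simp
          linarith
        linarith
    · have h1 := mixKernel_le_of_logKernel hq hq1 hε0 hε1 hD (c := 0)
        (by linarith [logKernel_le_neg_log_chordSq hε0 hε1 hD])
      linarith

/-- Follows from `mixKernel ≥ -log 2` and the comparison, as `1 - log 2` exceeds the two errors of
at most `1/10`. Nonnegativity is needed in order to multiply the comparison over the coordinates. -/
lemma one_add_cosSum_nonneg (hq : 0 < q) (hq1 : q < 1) (hK0 : 0 < K)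
    (hK : (16 / (1 - q)) ^ 2 + 1 / (1 - q) ≤ Real.log K)
    (hKN : 10 * K ≤ N) (hn : N ≤ n) (x : ℝ) : 0 ≤ 1 + cosSum n x := by
  have hN : (0 : ℝ) < N := by linarith
  have hp : 0 < 1 - q := by linarith
  have hcb := comparison_const_bounds hq hq1 hK hK0
  have hε1 : K / N ≤ 1 / 10 := by rw [div_le_iff₀ hN]; linarith
  have h1 := neg_log_two_le_mixKernel hq hq1 (by positivity : 0 < K / N) (by linarith) x
  have h2 := mixKernel_le_cosSum_add hq hq1 hK0 hK (by linarith) hn (x := x)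
  have h3 := Real.log_two_lt_d9
  rcases le_or_gt √(chordSq x) ((1 - q) * (K / N) * K / 8) with h | h
  · linarith [h2.1 h]
  · have h4 := h2.2 h
    have h5 : 2 / (N * √(chordSq x)) ≤ 1 / 10 := by
      have hK1 : 1 ≤ K := by
        have : (1 - q) ^ 2 ≤ 1 := by nlinarith
        nlinarith
      have h6 : 32 ≤ N * ((1 - q) * (K / N) * K / 8) := by
        have : N * ((1 - q) * (K / N) * K / 8) = (1 - q) * K ^ 2 / 8 := by field_simp
        rw [this]
        nlinarith [mul_nonneg hp.le hK0.le, mul_nonneg hq.le (mul_nonneg hp.le hK0.le)]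
      have h7 := mul_lt_mul_of_pos_left h hN
      rw [div_le_iff₀ (by linarith)]
      linarith
    linarith

end comparison

/-! ### The comparison error as a sum of Poisson kernels. -/

lemma poissonKer_nonneg {r : ℝ} (h0 : 0 ≤ r) (h1 : r < 1) (x : ℝ) : 0 ≤ poissonKer r x :=
  div_nonneg (by nlinarith) (poissonDen_pos h0 h1 x).le

lemma one_sub_pow_mul_le_one {y : ℝ} (h0 : 0 ≤ y) (h1 : y ≤ 1) (k : ℕ) :
    k * y * (1 - y) ^ k ≤ 1 := by
  have hb := one_add_mul_le_pow (a := y) (by linarith) k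
  have h2 : (1 + y) ^ k * (1 - y) ^ k ≤ 1 := by
    rw [← mul_pow]
    exact pow_le_one₀ (by nlinarith) (by nlinarith)
  have h3 : 0 ≤ (1 - y) ^ k := pow_nonneg (by linarith) k
  nlinarith [mul_le_mul_of_nonneg_right hb h3]

/-- The Poisson kernel at a coarse scale `t`, without its mean, is dominated by the logarithmic
kernel at a finer scale `ε`. -/
lemma poissonKer_sub_one_le_logKernel {ε t : ℝ} (hε : 0 < ε) (hεt : 2 * ε ≤ t) (ht : t ≤ 1)
    (y : ℕ → ℝ) :
    IsPSDKernel (fun m n => 4 / t * logKernel (1 - ε) (y m - y n)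
      - (poissonKer (1 - t) (y m - y n) - 1)) := by
  have ht0 : 0 < t := by linarith
  refine IsPSDKernel.of_hasSum_cos
    (a := fun k => 4 / t * ((1 - ε) ^ k / k) - if k = 0 then 0 else 2 * (1 - t) ^ k)
    (f := fun x => 4 / t * logKernel (1 - ε) x - (poissonKer (1 - t) x - 1)) (fun k => ?_)
    (fun x => ?_) y
  · split_ifs with hk
    · simp [hk]
    · have hk0 : (0 : ℝ) < k := by exact_mod_cast Nat.pos_of_ne_zero hk
      -- Half of the decay at scale `t` suffices to produce `(1 - ε)^k`; the other half, `(1 -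
      -- t/2)^k`, compensates the factor `k` of the logarithmic coefficients.
      have h1 : (1 - t) ^ k ≤ ((1 - ε) * (1 - t / 2)) ^ k :=
        pow_le_pow_left₀ (by linarith) (by nlinarith) k
      have h2 := one_sub_pow_mul_le_one (y := t / 2) (by linarith) (by linarith) k
      have h3 : 0 ≤ (1 - ε) ^ k := pow_nonneg (by linarith) k
      rw [mul_pow] at h1
      rw [sub_nonneg, div_mul_div_comm, le_div_iff₀ (by positivity)]
      have h4 := mul_le_mul_of_nonneg_left h2 h3
      have h5 := mul_le_mul_of_nonneg_right h1 (by positivity : 0 ≤ k * (t / 2))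
      nlinarith
  · have h := ((hasSum_logKernel (r := 1 - ε) (by linarith) (by linarith) x).mul_left (4 / t)).sub
      (hasSum_poissonKer (r := 1 - t) (by linarith) (by linarith) x)
    have ef : (fun k : ℕ => (4 / t * ((1 - ε) ^ k / k) - if k = 0 then 0 else 2 * (1 - t) ^ k)
        * Real.cos (2 * Real.pi * k * x)) = fun k : ℕ =>
        4 / t * ((1 - ε) ^ k / k * Real.cos (2 * Real.pi * k * x))
        - (if k = 0 then 0 else 2 * (1 - t) ^ k) * Real.cos (2 * Real.pi * k * x) := by
      ext k; ring
    rw [ef]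
    exact h

lemma inv_le_poissonKer {t s x : ℝ} (ht : 0 < t) (ht1 : t ≤ 1) (hs : s ^ 2 = chordSq x)
    (hts : t ≤ s) (hst : s ≤ 2 * t) : 1 / s ≤ 5 * poissonKer (1 - t) x := by
  have hd := poissonDen_pos (r := 1 - t) (by linarith) (by linarith) x
  have h1 : poissonDen (1 - t) x ≤ 5 * t ^ 2 := by
    unfold poissonDen
    rw [← hs]
    have : s ^ 2 ≤ 4 * t ^ 2 := by nlinarith
    nlinarith [sq_nonneg s]
  unfold poissonKer
  rw [mul_div_assoc', div_le_div_iff₀ (by linarith) hd]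
  nlinarith [mul_nonneg ht.le (sub_nonneg.2 ht1), mul_nonneg (mul_nonneg ht.le (sub_nonneg.2 ht1))
    (sub_nonneg.2 hts)]

lemma inv_le_sum_poissonKer {τ : ℝ} (hτ : 0 < τ) {I : ℕ}
    (hI : 2 ^ I * τ ≤ 1) (hI' : 1 < 2 ^ (I + 1) * τ) {s x : ℝ} (hs : s ^ 2 = chordSq x)
    (hτs : τ ≤ s) :
    1 / s ≤ 1 + 5 * ∑ i ∈ Finset.range (I + 1), poissonKer (1 - 2 ^ i * τ) x := by
  have hs0 : 0 < s := by linarith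
  have ht : ∀ i ∈ Finset.range (I + 1), 2 ^ i * τ ≤ 1 := fun i hi => by
    refine le_trans ?_ hI
    have : i ≤ I := by simpa [Nat.lt_succ_iff] using hi
    gcongr
    norm_num
  have hnn : ∀ i ∈ Finset.range (I + 1), 0 ≤ poissonKer (1 - 2 ^ i * τ) x := fun i hi =>
    poissonKer_nonneg (by linarith [ht i hi]) (by have : 0 < 2 ^ i * τ := by positivity
                                                  linarith) x
  rcases le_or_gt s 1 with h1 | h1
  · obtain ⟨i, hi1, hi2⟩ := exists_nat_pow_near ((one_le_div hτ).2 hτs) (one_lt_two (α := ℝ))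
    rw [le_div_iff₀ hτ] at hi1
    rw [div_lt_iff₀ hτ] at hi2
    have hi : i ∈ Finset.range (I + 1) := by
      rw [Finset.mem_range]
      by_contra hcon
      push Not at hcon
      have : (2 : ℝ) ^ (I + 1) * τ ≤ 2 ^ i * τ := by gcongr; norm_num
      linarith
    have h2 := inv_le_poissonKer (by positivity) (ht i hi) hs hi1 (by rw [pow_succ] at hi2; linarith)
    have h3 := Finset.single_le_sum hnn hi
    linarith
  · have h2 : 1 / s ≤ 1 := (div_le_one hs0).2 h1.le
    have h3 := Finset.sum_nonneg hnn
    linarith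

/-- The truncated kernel, up to a function `Q` of small mean that is otherwise dominated by a small
multiple of the mixed kernel, is at least the mixed kernel. -/
lemma exists_comparison_majorant {q K : ℝ} {N : ℕ} (hq : 0 < q) (hq1 : q < 1) (hK0 : 0 < K)
    (hK : (16 / (1 - q)) ^ 2 + 1 / (1 - q) ≤ Real.log K) (hKN : K ^ 2 ≤ N) :
    ∃ (Q : ℝ → ℝ) (c : ℝ), (∀ x, 0 ≤ Q x) ∧
      (∀ n, N ≤ n → ∀ x, mixKernel q (K / N) x ≤ cosSum n x + Q x) ∧
      0 ≤ c ∧ c ≤ (K + 12 + 20 * Real.log N) / N ∧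
      ∀ y : ℕ → ℝ, IsPSDKernel (fun m n =>
        640 / ((1 - q) ^ 2 * K ^ 2) * mixKernel q (K / N) (y m - y n) - (Q (y m - y n) - c)) := by
  have hp : 0 < 1 - q := by linarith
  have hcb := comparison_const_bounds hq hq1 hK hK0
  have hpK : 256 ≤ (1 - q) * K := by nlinarith [mul_nonneg hq.le (mul_nonneg hp.le hK0.le)]
  have hK1 : 256 ≤ K := by nlinarith
  have hN : (0 : ℝ) < N := by nlinarith
  set ε := K / N with hε
  have hε0 : 0 < ε := by positivity
  have hNε : N * ε = K := by rw [hε]; field_simp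
  set τ := (1 - q) * ε * K / 8 with hτ
  have hτ0 : 0 < τ := by positivity
  have hτε : 2 * ε ≤ τ := by rw [hτ]; nlinarith
  have hτ1 : τ ≤ 1 := by
    have : ε * K ≤ 1 := by rw [hε, div_mul_eq_mul_div, div_le_one hN]; linarith
    rw [hτ]; nlinarith
  obtain ⟨I, hI1, hI2⟩ := exists_nat_pow_near ((one_le_div hτ0).2 hτ1) (one_lt_two (α := ℝ))
  rw [le_div_iff₀ hτ0] at hI1
  rw [div_lt_iff₀ hτ0] at hI2
  have ht : ∀ i ∈ Finset.range (I + 1), 2 ^ i * τ ≤ 1 := fun i hi => by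
    refine le_trans ?_ hI1
    have : i ≤ I := by simpa [Nat.lt_succ_iff] using hi
    gcongr
    norm_num
  have ht2 : ∀ i : ℕ, τ ≤ 2 ^ i * τ := fun i =>
    le_mul_of_one_le_left hτ0.le (one_le_pow₀ one_le_two)
  have hnn : ∀ x, 0 ≤ ∑ i ∈ Finset.range (I + 1), poissonKer (1 - 2 ^ i * τ) x := fun x =>
    Finset.sum_nonneg fun i hi => poissonKer_nonneg (by linarith [ht i hi]) (by linarith [ht2 i]) x
  -- The remaining error `2 / (N s)` for `s > τ` is majorised by Poisson kernels at the dyadic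
  -- scales `2^i τ`. Each has mean `1`, so `c` is the mean of `Q`; the number of scales gives the
  -- factor `log N`.
  refine ⟨fun x => ε + 2 / N * (1 + 5 * ∑ i ∈ Finset.range (I + 1), poissonKer (1 - 2 ^ i * τ) x),
    ε + 2 / N + 10 / N * (I + 1), fun x => ?_, fun n hn x => ?_, by positivity, ?_, fun y => ?_⟩
  · have := hnn x
    positivity
  · have h1 := mixKernel_le_cosSum_add hq hq1 hK0 hK (by nlinarith) hn (x := x)
    dsimp only
    rcases le_or_gt √(chordSq x) ((1 - q) * (K / N) * K / 8) with h | h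
    · have h2 := h1.1 h
      have h3 : 0 ≤ 2 / (N : ℝ) * (1 + 5 * ∑ i ∈ Finset.range (I + 1),
        poissonKer (1 - 2 ^ i * τ) x) := by
        have := hnn x
        positivity
      linarith
    · have h2 := h1.2 h
      have h3 := inv_le_sum_poissonKer hτ0 hI1 hI2 (Real.sq_sqrt (chordSq_nonneg x)) h.le
      have h4 := mul_le_mul_of_nonneg_left h3 (by positivity : 0 ≤ 2 / (N : ℝ))
      rw [div_mul_div_comm, mul_one] at h4
      linarith
  · have h1 : (I : ℝ) * Real.log 2 ≤ Real.log N := by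
      rw [← Real.log_pow]
      apply Real.log_le_log (by positivity)
      have h2 : 1 ≤ N * τ := by nlinarith
      have h3 : 0 < (2 : ℝ) ^ I := by positivity
      nlinarith
    have h2 : (I : ℝ) ≤ 2 * Real.log N := by
      have := Real.log_two_gt_d9
      have hI0 : (0 : ℝ) ≤ I := Nat.cast_nonneg I
      nlinarith
    rw [hε, div_mul_eq_mul_div, ← add_div, ← add_div]
    refine div_le_div_of_nonneg_right ?_ hN.le
    linarith
  · set η := 640 / ((1 - q) ^ 2 * K ^ 2) with hη
    have hη0 : 0 ≤ η := by positivity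
    have hε1 : ε ≤ 1 / 2 := by linarith
    have h1 := (logKernel_le_mixKernel hq hq1 hε0 (by linarith) y).const_mul hη0
    have h2 := (IsPSDKernel.sum (Finset.range (I + 1)) fun i hi =>
      poissonKer_sub_one_le_logKernel hε0 (hτε.trans (ht2 i)) (ht i hi) y).const_mul
        (by positivity : 0 ≤ 10 / (N : ℝ))
    -- The geometric sum is dominated by the finest scale: the left side is at most `80 / (N τ)`,
    -- and `N τ = (1 - q) K² / 8`. This gives `640` and makes `η` small for large `K`.
    have h3 : 10 / (N : ℝ) * ∑ i ∈ Finset.range (I + 1), 4 / (2 ^ i * τ) ≤ η * (1 - q) := by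
      have h4 : ∑ i ∈ Finset.range (I + 1), 4 / ((2 : ℝ) ^ i * τ) ≤ 8 / τ := by
        have h5 : ∑ i ∈ Finset.range (I + 1), (1 / 2 : ℝ) ^ i ≤ 2 := by
          exact (summable_geometric_two.sum_le_tsum _ fun i _ => by positivity).trans_eq
            tsum_geometric_two
        have h6 : ∑ i ∈ Finset.range (I + 1), 4 / ((2 : ℝ) ^ i * τ)
            = 4 / τ * ∑ i ∈ Finset.range (I + 1), (1 / 2 : ℝ) ^ i := by
          rw [Finset.mul_sum]
          refine Finset.sum_congr rfl fun i _ => ?_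
          rw [one_div, inv_pow]
          field_simp
        rw [h6]
        calc _ ≤ 4 / τ * 2 := by gcongr
          _ = 8 / τ := by ring
      calc _ ≤ 10 / (N : ℝ) * (8 / τ) := by gcongr
        _ = η * (1 - q) := by
          rw [hη, hτ, hε]; field_simp; norm_num
    have h4 := (isPSDKernel_logKernel (r := 1 - ε) (by linarith) (by linarith) y).const_mul
      (sub_nonneg.2 h3)
    refine ((h1.add h2).add h4).congr fun m n => ?_
    rw [Finset.sum_sub_distrib, Finset.sum_sub_distrib, ← Finset.sum_mul]
    simp only [Finset.sum_const, Finset.card_range, nsmul_eq_mul, mul_one]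
    push_cast
    ring

/-! ### Norms of test functions in the reproducing kernel space. -/

lemma smoothSaw_rankOne_le {r : ℝ} (h0 : 0 < r) (h1 : r < 1) (α : ℝ) (y : ℕ → ℝ) :
    IsPSDKernel (fun m n => (-Real.log (1 - r) + 3 / r) * logKernel r (y m - y n)
      - smoothSaw r (y m - α) * smoothSaw r (y n - α)) := by
  have hβ : 0 ≤ (1 - r) / r := div_nonneg (by linarith) h0.le
  refine IsPSDKernel.rankOne_le_of_hasSum (a := fun k => r ^ k / k)
    (b := fun k => Real.pi⁻¹ * (r ^ k * (1 + k * ((1 - r) / r)) / k))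
    -- This is `b k ^ 2 / a k` without the factor `π⁻²`. The three series sum to `-log (1 - r)`, `2
    -- / r` and `1 / r`.
    (ρ := fun k => r ^ k / k + 2 * ((1 - r) / r) * r ^ k + ((1 - r) / r) ^ 2 * (k * r ^ k))
    (fun k => by positivity) (fun k => by positivity) (fun k => ?_) ?_
    (hasSum_logKernel h0.le h1) (Real.pi / 2) α (hasSum_smoothSaw h0.le h1) y
  · rcases eq_or_ne k 0 with rfl | hk
    · simp
    · have hk0 : (k : ℝ) ≠ 0 := by exact_mod_cast hk
      have hpi : (Real.pi⁻¹) ^ 2 ≤ 1 := by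
        apply pow_le_one₀ (by positivity)
        exact inv_le_one_of_one_le₀ (by linarith [Real.pi_gt_three])
      set β := (1 - r) / r
      rw [mul_pow]
      calc _ ≤ 1 * (r ^ k * (1 + k * β) / k) ^ 2 := by gcongr
        _ = _ := by field_simp; ring
  · have hs1 := hasSum_logKernel h0.le h1 0
    simp only [mul_zero, Real.cos_zero, mul_one] at hs1
    have hl : logKernel r 0 = -Real.log (1 - r) := by
      rw [logKernel, poissonDen, chordSq]
      simp
    rw [hl] at hs1
    have hs2 := (hasSum_geometric_of_lt_one h0.le h1).mul_left (2 * ((1 - r) / r))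
    have hs3 := (hasSum_coe_mul_geometric_of_norm_lt_one (r := r)
      (by rwa [Real.norm_of_nonneg h0.le])).mul_left (((1 - r) / r) ^ 2)
    have hs := (hs1.add hs2).add hs3
    have hne : 1 - r ≠ 0 := by linarith
    have ev : -Real.log (1 - r) + 3 / r = -Real.log (1 - r) + 2 * ((1 - r) / r) * (1 - r)⁻¹
        + ((1 - r) / r) ^ 2 * (r / (1 - r) ^ 2) := by
      field_simp; ring
    rw [ev]
    exact hs

lemma poissonKer_rankOne_le {r : ℝ} (h0 : 0 ≤ r) (h1 : r < 1) (α : ℝ) (y : ℕ → ℝ) :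
    IsPSDKernel (fun m n => 4 * (r / (1 - r) ^ 2) * logKernel r (y m - y n)
      - (poissonKer r (y m - α) - 1) * (poissonKer r (y n - α) - 1)) := by
  refine IsPSDKernel.rankOne_le_of_hasSum (a := fun k => r ^ k / k)
    (b := fun k => if k = 0 then 0 else 2 * r ^ k)
    (ρ := fun k => 4 * (k * r ^ k)) (g := fun x => poissonKer r x - 1)
    (fun k => by positivity) (fun k => by positivity) (fun k => ?_) ?_
    (hasSum_logKernel h0 h1) 0 α (fun x => by simpa only [add_zero] using hasSum_poissonKer h0 h1 x) y
  · rcases eq_or_ne k 0 with rfl | hk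
    · simp
    · have hk0 : (k : ℝ) ≠ 0 := by exact_mod_cast hk
      simp only [hk, if_false]
      apply le_of_eq
      field_simp
      ring
  · exact (hasSum_coe_mul_geometric_of_norm_lt_one (r := r)
      (by rwa [Real.norm_of_nonneg h0])).mul_left 4

/-- The remainder contains only products of the `a i`, never of the `b i`. With `a` the mixed and
`b` the truncated factors, it can therefore be estimated by the energy of the mixed kernel alone.
Splitting on `a k ≤ b k` or `b k ≤ a k` keeps the `b i` out. -/
lemma prod_le_prod_add_sum {ι : Type*} [DecidableEq ι] (s : Finset ι) {a b Q : ι → ℝ}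
    (ha : ∀ i ∈ s, 0 ≤ a i) (hb : ∀ i ∈ s, 0 ≤ b i) (hQ : ∀ i ∈ s, 0 ≤ Q i)
    (h : ∀ i ∈ s, a i ≤ b i + Q i) :
    ∏ i ∈ s, a i ≤ ∏ i ∈ s, b i + ∑ j ∈ s, Q j * ∏ i ∈ s.erase j, a i := by
  induction s using Finset.induction_on with
  | empty => simp
  | insert k s hk ih =>
    have ih' := ih (fun i hi => ha i (by simp [hi])) (fun i hi => hb i (by simp [hi]))
      (fun i hi => hQ i (by simp [hi])) fun i hi => h i (by simp [hi])
    have e : ∑ j ∈ s, Q j * ∏ i ∈ (insert k s).erase j, a i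
        = a k * ∑ j ∈ s, Q j * ∏ i ∈ s.erase j, a i := by
      rw [Finset.mul_sum]
      refine Finset.sum_congr rfl fun j hj => ?_
      have hjk : k ≠ j := fun h => hk (h ▸ hj)
      rw [Finset.erase_insert_of_ne hjk, Finset.prod_insert (by simp [hk])]
      ring
    rw [Finset.prod_insert hk, Finset.prod_insert hk, Finset.sum_insert hk,
      Finset.erase_insert hk, e]
    have hak := ha k (by simp)
    have hbk := hb k (by simp)
    have hQk := hQ k (by simp)
    have hA : 0 ≤ ∏ i ∈ s, a i := Finset.prod_nonneg fun i hi => ha i (by simp [hi])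
    have hB : 0 ≤ ∏ i ∈ s, b i := Finset.prod_nonneg fun i hi => hb i (by simp [hi])
    have hS : 0 ≤ ∑ j ∈ s, Q j * ∏ i ∈ s.erase j, a i := Finset.sum_nonneg fun j hj =>
      mul_nonneg (hQ j (by simp [hj])) (Finset.prod_nonneg fun i hi =>
        ha i (by simp [Finset.mem_of_mem_erase hi]))
    have hk' := h k (by simp)
    rcases le_total (a k) (b k) with hab | hab
    · nlinarith [mul_le_mul_of_nonneg_left ih' hak, mul_le_mul_of_nonneg_right hab hB,
        mul_nonneg hQk hA]
    · nlinarith [mul_le_mul_of_nonneg_left ih' hbk, mul_le_mul_of_nonneg_right hab hS,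
        mul_le_mul_of_nonneg_right hk' hA]

/-! ### Energy of the points and its growth. -/

/-- The product kernel `∏ j (1 + h (x_{m,j} - x_{n,j}))` of the mixed kernel `h`. -/
noncomputable def boxKernel {d : ℕ} (q ε : ℝ) (x : ℕ → Fin d → ℝ) (m n : ℕ) : ℝ :=
  ∏ j, (1 + mixKernel q ε (x m j - x n j))

/-- The energy of the first `M` points for the product kernel, less its mean. -/
noncomputable def energyExcess {d : ℕ} (q ε : ℝ) (x : ℕ → Fin d → ℝ) (M : ℕ) : ℝ :=
  ∑ m ∈ Finset.Icc 1 M, ∑ n ∈ Finset.Icc 1 M, (boxKernel q ε x m n - 1)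

section energy

variable {d : ℕ} {q ε : ℝ}

lemma isPSDKernel_boxKernel_sub_one (hq : 0 < q) (hq1 : q < 1) (hε : 0 < ε) (hε1 : ε ≤ 1)
    (x : ℕ → Fin d → ℝ) : IsPSDKernel (fun m n => boxKernel q ε x m n - 1) :=
  IsPSDKernel.prod_one_add_sub_one Finset.univ fun j _ =>
    isPSDKernel_mixKernel hq hq1 hε hε1 fun n => x n j

lemma energyExcess_nonneg (hq : 0 < q) (hq1 : q < 1) (hε : 0 < ε) (hε1 : ε ≤ 1)
    (x : ℕ → Fin d → ℝ) (M : ℕ) : 0 ≤ energyExcess q ε x M :=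
  (isPSDKernel_boxKernel_sub_one hq hq1 hε hε1 x).sum_nonneg _

lemma energyExcess_half_le (hq : 0 < q) (hq1 : q < 1) (hε : 0 < ε) (hε1 : ε ≤ 1)
    (x : ℕ → Fin d → ℝ) (M : ℕ) :
    energyExcess q (ε / 2) x M ≤ (q⁻¹) ^ d * energyExcess q ε x M := by
  have h := (IsPSDKernel.prod_one_add_rescale (Finset.univ : Finset (Fin d)) hq hq1.le
    (fun j _ => isPSDKernel_mixKernel hq hq1 hε hε1 fun n => x n j)
    (fun j _ => isPSDKernel_mixKernel hq hq1 (half_pos hε) (by linarith) fun n => x n j)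
    (fun j _ => mixKernel_half_le hq hq1 hε hε1 fun n => x n j)).sum_mono (Finset.Icc 1 M)
  rw [Finset.card_univ, Fintype.card_fin] at h
  unfold energyExcess boxKernel
  rw [Finset.mul_sum]
  simp only [Finset.mul_sum]
  exact h

lemma one_add_mixKernel_nonneg (hq : 0 < q) (hq1 : q < 1) (hε : 0 < ε) (hε1 : ε ≤ 1) (x : ℝ) :
    0 ≤ 1 + mixKernel q ε x := by
  have := neg_log_two_le_mixKernel hq hq1 hε hε1 x
  have := Real.log_two_lt_d9
  linarith

lemma boxKernel_le (hq : 0 < q) (hq1 : q < 1) (hε : 0 < ε) (hε1 : ε ≤ 1)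
    (x : ℕ → Fin d → ℝ) (m n : ℕ) :
    boxKernel q ε x m n ≤ (1 - Real.log ε + 1 / (1 - q)) ^ d := by
  have h := Finset.prod_le_prod (s := (Finset.univ : Finset (Fin d)))
    (f := fun j => 1 + mixKernel q ε (x m j - x n j))
    (g := fun _ => 1 - Real.log ε + 1 / (1 - q))
    (fun j _ => one_add_mixKernel_nonneg hq hq1 hε hε1 _)
    (fun j _ => by linarith [mixKernel_le_neg_log hq hq1 hε hε1 (x m j - x n j)])
  simpa [boxKernel] using h

lemma energyExcess_eq (x : ℕ → Fin d → ℝ) (M : ℕ) :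
    energyExcess q ε x M
      = ∑ m ∈ Finset.Icc 1 M, ∑ n ∈ Finset.Icc 1 M, boxKernel q ε x m n - (M : ℝ) ^ 2 := by
  simp [energyExcess, Finset.sum_sub_distrib]
  ring

/-- If the mixed kernel is at most `b + Q`, this bounds the contribution of `Q` to the product
kernel. -/
noncomputable def errorKernel (q ε : ℝ) (Q : ℝ → ℝ) (x : ℕ → Fin d → ℝ) (m n : ℕ) : ℝ :=
  ∑ j, Q (x m j - x n j) * ∏ i ∈ Finset.univ.erase j, (1 + mixKernel q ε (x m i - x n i))

lemma errorKernel_nonneg (hq : 0 < q) (hq1 : q < 1) (hε : 0 < ε) (hε1 : ε ≤ 1) {Q : ℝ → ℝ}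
    (hQ : ∀ y, 0 ≤ Q y) (x : ℕ → Fin d → ℝ) (m n : ℕ) : 0 ≤ errorKernel q ε Q x m n :=
  Finset.sum_nonneg fun _ _ => mul_nonneg (hQ _) (Finset.prod_nonneg fun _ _ =>
    one_add_mixKernel_nonneg hq hq1 hε hε1 _)

/-- `Q` is replaced by `c + η * mixKernel` in the positive semidefinite order, and the result
multiplied by the other factors. Such a bound holds for full double sums rather than for single
points, which is why the error is carried over all pairs up to `M`. -/
lemma sum_errorKernel_le (hq : 0 < q) (hq1 : q < 1) (hε : 0 < ε) (hε1 : ε ≤ 1) {Q : ℝ → ℝ}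
    {c η : ℝ} (hc : 0 ≤ c) (hη : 0 ≤ η)
    (hQ : ∀ y : ℕ → ℝ, IsPSDKernel (fun m n =>
      η * mixKernel q ε (y m - y n) - (Q (y m - y n) - c)))
    (x : ℕ → Fin d → ℝ) (M : ℕ) :
    ∑ m ∈ Finset.Icc 1 M, ∑ n ∈ Finset.Icc 1 M, errorKernel q ε Q x m n
      ≤ d * (c * (M : ℝ) ^ 2 + (c + η) * energyExcess q ε x M) := by
  have hj : ∀ j : Fin d, IsPSDKernel (fun m n => (c + η * (boxKernel q ε x m n - 1)
      + c * (boxKernel q ε x m n - 1))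
      - Q (x m j - x n j) * ∏ i ∈ Finset.univ.erase j, (1 + mixKernel q ε (x m i - x n i))) := by
    intro j
    have hH : ∀ i : Fin d, IsPSDKernel (fun m n => mixKernel q ε (x m i - x n i)) := fun i =>
      isPSDKernel_mixKernel hq hq1 hε hε1 fun n => x n i
    have hP1 := IsPSDKernel.prod_one_add_sub_one (Finset.univ.erase j) fun i _ => hH i
    have hP := IsPSDKernel.prod (Finset.univ.erase j) fun i _ =>
      (IsPSDKernel.const zero_le_one).add (hH i)
    have h1 := (hQ fun n => x n j).mul hP
    have h2 := hP1.const_mul hη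
    have h3 := ((hH j).mul hP).const_mul hc
    refine ((h1.add h2).add h3).congr fun m n => ?_
    have e : boxKernel q ε x m n = (1 + mixKernel q ε (x m j - x n j)) *
        ∏ i ∈ Finset.univ.erase j, (1 + mixKernel q ε (x m i - x n i)) :=
      (Finset.mul_prod_erase _ _ (Finset.mem_univ j)).symm
    rw [e]
    ring
  have h := (IsPSDKernel.sum Finset.univ fun j _ => hj j).sum_nonneg (Finset.Icc 1 M)
  have e : ∑ m ∈ Finset.Icc 1 M, ∑ n ∈ Finset.Icc 1 M, ∑ j : Fin d,
      ((c + η * (boxKernel q ε x m n - 1) + c * (boxKernel q ε x m n - 1))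
      - Q (x m j - x n j) * ∏ i ∈ Finset.univ.erase j, (1 + mixKernel q ε (x m i - x n i)))
      = d * (c * (M : ℝ) ^ 2 + (c + η) * energyExcess q ε x M)
        - ∑ m ∈ Finset.Icc 1 M, ∑ n ∈ Finset.Icc 1 M, errorKernel q ε Q x m n := by
    have e1 : ∀ m n, ∑ j : Fin d,
      ((c + η * (boxKernel q ε x m n - 1) + c * (boxKernel q ε x m n - 1))
      - Q (x m j - x n j) * ∏ i ∈ Finset.univ.erase j, (1 + mixKernel q ε (x m i - x n i)))
      = (d * c + d * (c + η) * (boxKernel q ε x m n - 1)) - errorKernel q ε Q x m n := by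
      intro m n
      rw [Finset.sum_sub_distrib, errorKernel]
      simp only [Finset.sum_const, Finset.card_univ, Fintype.card_fin, nsmul_eq_mul]
      ring
    simp only [e1, energyExcess]
    obtain ⟨G, hG⟩ : ∃ G : ℕ → ℕ → ℝ, ∀ m n, boxKernel q ε x m n - 1 = G m n := ⟨_, fun _ _ => rfl⟩
    simp only [hG, Finset.sum_sub_distrib, Finset.sum_add_distrib, ← Finset.mul_sum,
      Finset.sum_const, Nat.card_Icc, nsmul_eq_mul, add_tsub_cancel_right]
    ring
  rw [e] at h
  linarith

lemma cosSum_neg (n : ℕ) (x : ℝ) : cosSum n (-x) = cosSum n x := by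
  unfold cosSum
  refine Finset.sum_congr rfl fun k _ => ?_
  rw [mul_neg, Real.cos_neg]

lemma sum_Icc_sum_Icc_succ (F : ℕ → ℕ → ℝ) (M : ℕ) :
    ∑ m ∈ Finset.Icc 1 (M + 1), ∑ n ∈ Finset.Icc 1 (M + 1), F m n
      = ∑ m ∈ Finset.Icc 1 M, ∑ n ∈ Finset.Icc 1 M, F m n
        + ∑ m ∈ Finset.Icc 1 M, (F (M + 1) m + F m (M + 1)) + F (M + 1) (M + 1) := by
  rw [Finset.sum_Icc_succ_top (by omega)]
  simp only [Finset.sum_Icc_succ_top (show 1 ≤ M + 1 by omega), Finset.sum_add_distrib]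
  ring

/-- Growth of the energy while the points between `N` and `M` are added. -/
lemma energyExcess_le_add {x : ℕ → Fin d → ℝ} {N : ℕ}
    (hq : 0 < q) (hq1 : q < 1) (hε : 0 < ε) (hε1 : ε ≤ 1) {Q : ℝ → ℝ}
    (hQ : ∀ y, 0 ≤ Q y) (hcos : ∀ n, N ≤ n → ∀ y, 0 ≤ 1 + cosSum n y)
    (hle : ∀ n, N ≤ n → ∀ y, mixKernel q ε y ≤ cosSum n y + Q y)
    (hrule : ∀ n, N < n → greedySum x n ≤ (n : ℝ) - 1) {M : ℕ} (hM : N ≤ M) :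
    energyExcess q ε x M ≤ energyExcess q ε x N
      + ∑ m ∈ Finset.Icc 1 M, ∑ n ∈ Finset.Icc 1 M, errorKernel q ε Q x m n
      + ((M : ℝ) - N) * (1 - Real.log ε + 1 / (1 - q)) ^ d := by
  induction M, hM using Nat.le_induction with
  | base =>
    have : 0 ≤ ∑ m ∈ Finset.Icc 1 N, ∑ n ∈ Finset.Icc 1 N, errorKernel q ε Q x m n :=
      Finset.sum_nonneg fun m _ => Finset.sum_nonneg fun n _ =>
        errorKernel_nonneg hq hq1 hε hε1 hQ x m n
    linarith
  | succ M hM ih =>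
    have hcmp : ∀ m, (boxKernel q ε x (M + 1) m
        ≤ ∏ j, (1 + cosSum (M + 1) (x (M + 1) j - x m j)) + errorKernel q ε Q x (M + 1) m) ∧
        (boxKernel q ε x m (M + 1)
        ≤ ∏ j, (1 + cosSum (M + 1) (x (M + 1) j - x m j)) + errorKernel q ε Q x m (M + 1)) := by
      intro m
      constructor
      · exact prod_le_prod_add_sum Finset.univ
          (fun j _ => one_add_mixKernel_nonneg hq hq1 hε hε1 _)
          (fun j _ => hcos _ (by omega) _) (fun j _ => hQ _)
          fun j _ => by linarith [hle (M + 1) (by omega) (x (M + 1) j - x m j)]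
      · refine prod_le_prod_add_sum Finset.univ
          (fun j _ => one_add_mixKernel_nonneg hq hq1 hε hε1 _)
          (fun j _ => hcos _ (by omega) _) (fun j _ => hQ _)
          fun j _ => ?_
        have := hle (M + 1) (by omega) (x m j - x (M + 1) j)
        rw [← cosSum_neg, neg_sub] at this
        linarith
    -- The only use of the greedy rule. The bound `M` cancels against the mean, as `(M + 1)² - M² =
    -- 2 M + 1`.
    have hg : ∑ m ∈ Finset.Icc 1 M, ∏ j, (1 + cosSum (M + 1) (x (M + 1) j - x m j)) ≤ M := by
      have := hrule (M + 1) (by omega)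
      push_cast at this
      rw [add_sub_cancel_right] at this
      exact this
    have hs := Finset.sum_le_sum fun m (_ : m ∈ Finset.Icc 1 M) =>
      add_le_add (hcmp m).1 (hcmp m).2
    have hd := boxKernel_le hq hq1 hε hε1 x (M + 1) (M + 1)
    have hd2 := errorKernel_nonneg hq hq1 hε hε1 hQ x (M + 1) (M + 1)
    rw [energyExcess_eq, sum_Icc_sum_Icc_succ, sum_Icc_sum_Icc_succ (errorKernel q ε Q x)]
    rw [energyExcess_eq] at ih
    simp only [Finset.sum_add_distrib] at hs ⊢
    push_cast
    linarith

end energy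

/-! ### Choice of constants and induction over dyadic blocks. -/

/-- The constants of the energy estimate can be chosen so that all smallness conditions hold. -/
lemma exists_energy_constants {d : ℕ} (hd : 1 ≤ d) (m : ℕ) :
    ∃ q K : ℝ, 0 < q ∧ q < 1 ∧ 1 ≤ K ∧ (16 / (1 - q)) ^ 2 + 1 / (1 - q) ≤ Real.log K ∧
      (q⁻¹) ^ d ≤ 4 / 3 ∧ d * (640 / ((1 - q) ^ 2 * K ^ 2)) ≤ 1 / 16 ∧
      ∃ N₀ : ℕ, ∀ N : ℕ, N₀ ≤ N → m ≤ N ∧ K ^ 2 ≤ N ∧ 10 * K ≤ N ∧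
        d * ((K + 12 + 20 * Real.log N) / N) ≤ 1 / 16 ∧ 1 ≤ Real.log N ∧
        1 - Real.log (K / N) + 1 / (1 - q) ≤ 2 * Real.log N := by
  have hd' : (1 : ℝ) ≤ d := by exact_mod_cast hd
  have hd0 : (0 : ℝ) < d := by linarith
  -- With `q = 1 - p`, Bernoulli gives `q^d ≥ 1 - d p = 3/4`. Then `K` is chosen in terms of `p`,
  -- and `N₀` in terms of `K`.
  obtain ⟨p, hp⟩ : ∃ p : ℝ, p = 1 / (4 * d) := ⟨_, rfl⟩
  have hp0 : 0 < p := by rw [hp]; positivity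
  have hp1 : p ≤ 1 / 4 := by
    rw [hp]; exact one_div_le_one_div_of_le (by norm_num) (by linarith)
  have hdp : d * p = 1 / 4 := by rw [hp]; field_simp
  obtain ⟨K, hK1, hK2, hK3⟩ := ((Filter.eventually_ge_atTop (1 : ℝ)).and
    ((Real.tendsto_log_atTop.eventually_ge_atTop ((16 / p) ^ 2 + 1 / p)).and
    (Filter.eventually_ge_atTop (16 * d * 640 / p ^ 2)))).exists
  refine ⟨1 - p, K, by linarith, by linarith, hK1, by simpa using hK2, ?_, ?_, ?_⟩
  · have h1 := one_add_mul_le_pow (a := -p) (by linarith) d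
    have h2 : (3 / 4 : ℝ) ≤ (1 - p) ^ d := by
      rw [← sub_eq_add_neg] at h1
      linarith
    rw [inv_pow]
    calc _ ≤ (3 / 4 : ℝ)⁻¹ := inv_anti₀ (by norm_num) h2
      _ = 4 / 3 := by norm_num
  · rw [sub_sub_cancel, mul_div_assoc', div_le_iff₀ (by positivity)]
    rw [div_le_iff₀ (by positivity)] at hK3
    nlinarith [mul_nonneg (mul_nonneg (by linarith : (0:ℝ) ≤ K) (by linarith : 0 ≤ K - 1)) (sq_nonneg p)]
  · rw [← Filter.eventually_atTop]
    have hcast := tendsto_natCast_atTop_atTop (R := ℝ)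
    have hlog := Real.tendsto_log_atTop.comp hcast
    have hlo := hcast.eventually (Real.isLittleO_log_id_atTop.def
      (by positivity : (0 : ℝ) < 1 / (640 * d)))
    filter_upwards [Filter.eventually_ge_atTop m, hcast.eventually_ge_atTop (K ^ 2),
      hcast.eventually_ge_atTop (10 * K), hcast.eventually_ge_atTop (32 * d * (K + 12)),
      hlog.eventually_ge_atTop (1 + 1 / p), hlo] with N h1 h2 h3 h4 h5 h6
    have hN : (0 : ℝ) < N := by linarith
    rw [Function.comp_apply] at h5
    have hp' : 0 < 1 / p := by positivity
    refine ⟨h1, h2, h3, ?_, by linarith, ?_⟩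
    · rw [Real.norm_of_nonneg (by linarith), id, Real.norm_of_nonneg hN.le, div_mul_eq_mul_div,
        le_div_iff₀ (by positivity)] at h6
      rw [mul_div_assoc', div_le_iff₀ hN]
      linarith
    · rw [sub_sub_cancel, Real.log_div (by linarith) hN.ne']
      have := Real.log_nonneg hK1
      linarith

lemma energyExcess_block_le {d : ℕ} (hd : 1 ≤ d) {q K : ℝ} (hq : 0 < q) (hq1 : q < 1) (hK1 : 1 ≤ K)
    (hK : (16 / (1 - q)) ^ 2 + 1 / (1 - q) ≤ Real.log K)
    (hη : d * (640 / ((1 - q) ^ 2 * K ^ 2)) ≤ 1 / 16) {N M : ℕ} (hKN : K ^ 2 ≤ N)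
    (hKN' : 10 * K ≤ N) (hc : d * ((K + 12 + 20 * Real.log N) / N) ≤ 1 / 16)
    (hlog : 1 ≤ Real.log N) (hdiag : 1 - Real.log (K / N) + 1 / (1 - q) ≤ 2 * Real.log N)
    {x : ℕ → Fin d → ℝ} (hrule : ∀ n, N < n → greedySum x n ≤ (n : ℝ) - 1)
    (hNM : N ≤ M) (hMN : M ≤ 2 * N) :
    energyExcess q (K / N) x M ≤ 8 / 7 * (energyExcess q (K / N) x N
      + (4 * d * (K + 32) + 2 ^ d) * (N * Real.log N ^ d)) := by
  have hK0 : 0 < K := by linarith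
  have hN : (0 : ℝ) < N := by linarith
  have hp : 0 < 1 - q := by linarith
  have hNM' : (N : ℝ) ≤ M := by exact_mod_cast hNM
  have hMN' : (M : ℝ) ≤ 2 * N := by exact_mod_cast hMN
  have hε : 0 < K / N := by positivity
  have hε1 : K / N ≤ 1 := (div_le_one hN).2 (by linarith)
  obtain ⟨Q, c, hQ, hle, hc0, hcle, hpsd⟩ := exists_comparison_majorant hq hq1 hK0 hK hKN
  have h1 := energyExcess_le_add hq hq1 hε hε1 hQ
    (fun n hn y => one_add_cosSum_nonneg hq hq1 hK0 hK hKN' hn y) hle hrule hNM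
  have h2 := sum_errorKernel_le hq hq1 hε hε1 hc0 (by positivity) hpsd x M
  have hA := energyExcess_nonneg hq hq1 hε hε1 x M
  set A := energyExcess q (K / N) x M
  set L := Real.log N
  have hLd : L ≤ L ^ d := le_self_pow₀ hlog (by omega)
  have hd0 : (0 : ℝ) ≤ d := Nat.cast_nonneg d
  -- The energy after the block appears on both sides; moving `A / 8` to the left produces the
  -- factor `8/7`.
  have h3 : d * ((c + 640 / ((1 - q) ^ 2 * K ^ 2)) * A) ≤ A / 8 := by
    have : d * (c + 640 / ((1 - q) ^ 2 * K ^ 2)) ≤ 1 / 8 := by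
      have := mul_le_mul_of_nonneg_left hcle hd0
      linarith
    nlinarith [mul_le_mul_of_nonneg_right this hA]
  have h4 : d * (c * (M : ℝ) ^ 2) ≤ 4 * d * (K + 32) * (N * L ^ d) := by
    have e1 : (M : ℝ) ^ 2 ≤ (2 * N) ^ 2 := by gcongr
    have e2 : c * (M : ℝ) ^ 2 ≤ (K + 12 + 20 * L) / N * (2 * N) ^ 2 :=
      mul_le_mul hcle e1 (sq_nonneg _) (by positivity)
    have e3 : (K + 12 + 20 * L) / N * (2 * N) ^ 2 = 4 * (K + 12 + 20 * L) * N := by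
      field_simp; ring
    have e4 : K + 12 + 20 * L ≤ (K + 32) * L ^ d := by nlinarith
    have e5 := mul_le_mul_of_nonneg_right e4 hN.le
    have e6 : c * (M : ℝ) ^ 2 ≤ 4 * (K + 32) * (N * L ^ d) := by linarith
    calc _ ≤ d * (4 * (K + 32) * (N * L ^ d)) := by gcongr
      _ = _ := by ring
  have h5 : ((M : ℝ) - N) * (1 - Real.log (K / N) + 1 / (1 - q)) ^ d ≤ 2 ^ d * (N * L ^ d) := by
    have e0 : Real.log (K / N) ≤ 0 := Real.log_nonpos hε.le hε1
    have e1 : (1 - Real.log (K / N) + 1 / (1 - q)) ^ d ≤ (2 * L) ^ d := by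
      apply pow_le_pow_left₀ _ hdiag
      have : 0 < 1 / (1 - q) := by positivity
      linarith
    rw [mul_pow] at e1
    have e2 : 0 ≤ (2 : ℝ) ^ d * L ^ d := by positivity
    calc _ ≤ ((M : ℝ) - N) * (2 ^ d * L ^ d) := mul_le_mul_of_nonneg_left e1 (by linarith)
      _ ≤ N * (2 ^ d * L ^ d) := mul_le_mul_of_nonneg_right (by linarith) e2
      _ = _ := by ring
  linarith

/-- The energy of the first `M` points of a greedy sequence, at scale comparable to `1 / M`,
exceeds its mean by at most a multiple of `M (log M)^d`. -/
theorem exists_energyExcess_le {d : ℕ} (hd : 1 ≤ d) (m : ℕ) :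
    ∃ (q K C : ℝ) (N₀ : ℕ), 0 < q ∧ q < 1 ∧ 1 ≤ K ∧ 0 < C ∧ 10 * K ≤ N₀ ∧
      ∀ x : ℕ → Fin d → ℝ, (∀ n, m < n → greedySum x n ≤ (n : ℝ) - 1) → ∀ M : ℕ, N₀ ≤ M →
        ∃ ε : ℝ, K / M ≤ ε ∧ ε ≤ 2 * K / M ∧
          energyExcess q ε x M ≤ C * (M * Real.log M ^ d) := by
  obtain ⟨q, K, hq, hq1, hK1, hK, hqd, hη, N₀, hN₀⟩ := exists_energy_constants hd m
  have hp : 0 < 1 - q := by linarith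
  set C₁ : ℝ := 4 * d * (K + 32) + 2 ^ d with hC₁
  have hC₁0 : 0 < C₁ := by positivity
  -- The term `N₀ * 2 ^ d` covers the trivial bound at `N₀` points, valid for any points whatever,
  -- so the constant depends only on `d` and `m`. The term `4 * C₁` closes the doubling step: `4/3 ·
  -- 8/7 · 5/4 = 40/21 < 2`.
  set C₂ : ℝ := 4 * C₁ + N₀ * 2 ^ d with hC₂
  have hC₂0 : 0 < C₂ := by positivity
  have hNpos : ∀ N, N₀ ≤ N → (0 : ℝ) < N := fun N hN => by
    have := (hN₀ N hN).2.2.1; linarith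
  refine ⟨q, K, 8 / 7 * (C₂ + C₁), N₀, hq, hq1, hK1, by positivity, (hN₀ N₀ le_rfl).2.2.1,
    fun x hx M hM => ?_⟩
  have hblock : ∀ N M, N₀ ≤ N → N ≤ M → M ≤ 2 * N → energyExcess q (K / N) x M
      ≤ 8 / 7 * (energyExcess q (K / N) x N + C₁ * (N * Real.log N ^ d)) := by
    intro N M hN hNM hMN
    obtain ⟨h1, h2, h3, h4, h5, h6⟩ := hN₀ N hN
    exact energyExcess_block_le hd hq hq1 hK1 hK hη h2 h3 h4 h5 h6
      (fun n hn => hx n (by omega)) hNM hMN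
  have hdouble : ∀ j : ℕ, energyExcess q (K / (2 ^ j * N₀ : ℕ)) x (2 ^ j * N₀)
      ≤ C₂ * ((2 ^ j * N₀ : ℕ) * Real.log (2 ^ j * N₀ : ℕ) ^ d) := by
    intro j
    induction j with
    | zero =>
      rw [pow_zero, one_mul]
      obtain ⟨h1, h2, h3, h4, h5, h6⟩ := hN₀ N₀ le_rfl
      have hN := hNpos N₀ le_rfl
      have hε1 : K / N₀ ≤ 1 := (div_le_one hN).2 (by linarith)
      have hε : 0 < K / N₀ := by positivity
      have hsum : energyExcess q (K / N₀) x N₀ ≤ (N₀ : ℝ) ^ 2 * (2 * Real.log N₀) ^ d := by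
        have e1 : ∀ m n, boxKernel q (K / N₀) x m n - 1 ≤ (2 * Real.log N₀) ^ d := by
          intro m n
          have e2 := boxKernel_le hq hq1 hε hε1 x m n
          have e3 : (1 - Real.log (K / N₀) + 1 / (1 - q)) ^ d ≤ (2 * Real.log N₀) ^ d := by
            apply pow_le_pow_left₀ _ h6
            have : 0 < 1 / (1 - q) := by positivity
            linarith [Real.log_nonpos hε.le hε1]
          linarith
        calc energyExcess q (K / N₀) x N₀ ≤ ∑ m ∈ Finset.Icc 1 N₀, ∑ n ∈ Finset.Icc 1 N₀,
              (2 * Real.log N₀) ^ d :=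
            Finset.sum_le_sum fun m _ => Finset.sum_le_sum fun n _ => e1 m n
          _ = _ := by simp; ring
      refine hsum.trans ?_
      have : 0 ≤ 4 * C₁ * (N₀ * Real.log N₀ ^ d) := by positivity
      rw [mul_pow, hC₂]
      linarith
    | succ j ih =>
      have hNj : N₀ ≤ 2 ^ j * N₀ := Nat.le_mul_of_pos_left _ (by positivity)
      set N := 2 ^ j * N₀ with hNdef
      have hsucc : 2 ^ (j + 1) * N₀ = 2 * N := by rw [hNdef, pow_succ]; ring
      rw [hsucc]
      obtain ⟨h1, h2, h3, h4, h5, h6⟩ := hN₀ N hNj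
      have hN := hNpos N hNj
      have hε1 : K / N ≤ 1 := (div_le_one hN).2 (by linarith)
      have hε : 0 < K / N := by positivity
      have hb := hblock N (2 * N) hNj (by omega) le_rfl
      have hh := energyExcess_half_le hq hq1 hε hε1 x (2 * N)
      have hA := energyExcess_nonneg hq hq1 hε hε1 x (2 * N)
      have e : K / (2 * N : ℕ) = K / N / 2 := by push_cast; field_simp
      rw [e]
      have hL : Real.log N ^ d ≤ Real.log (2 * N : ℕ) ^ d := by
        apply pow_le_pow_left₀ (by linarith)
        apply Real.log_le_log hN
        push_cast; linarith
      have h7 : energyExcess q (K / N / 2) x (2 * N) ≤ 4 / 3 * (8 / 7 * ((C₂ + C₁) *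
          (N * Real.log N ^ d))) := by
        refine hh.trans ((mul_le_mul_of_nonneg_right hqd hA).trans ?_)
        gcongr
        linarith
      have hX : 0 ≤ N * Real.log N ^ d := by positivity
      have hC : C₁ ≤ C₂ / 4 := by
        rw [hC₂]
        have : 0 ≤ (N₀ : ℝ) * 2 ^ d := by positivity
        linarith
      have h8 := mul_le_mul_of_nonneg_right hC hX
      have h9 := mul_le_mul_of_nonneg_left (mul_le_mul_of_nonneg_left hL hN.le) hC₂0.le
      have h10 := mul_nonneg hC₂0.le hX
      push_cast at *
      linarith
  have hN := hNpos N₀ le_rfl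
  have hMpos := hNpos M hM
  have hMN : (1 : ℝ) ≤ M / N₀ := (one_le_div hN).2 (by exact_mod_cast hM)
  obtain ⟨j, hj1, hj2⟩ := exists_nat_pow_near hMN (one_lt_two (α := ℝ))
  rw [le_div_iff₀ hN] at hj1
  rw [div_lt_iff₀ hN] at hj2
  have hNj : N₀ ≤ 2 ^ j * N₀ := Nat.le_mul_of_pos_left _ (by positivity)
  have hj1' : 2 ^ j * N₀ ≤ M := by exact_mod_cast hj1
  have hj2' : M ≤ 2 * (2 ^ j * N₀) := by
    have : M < 2 ^ (j + 1) * N₀ := by exact_mod_cast hj2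
    rw [pow_succ] at this
    linarith
  have hd := hdouble j
  have hb := hblock _ M hNj hj1' hj2'
  set N := 2 ^ j * N₀
  have hNp := hNpos N hNj
  have hNM : (N : ℝ) ≤ M := by exact_mod_cast hj1'
  have hMN2 : (M : ℝ) ≤ 2 * N := by exact_mod_cast hj2'
  refine ⟨K / N, by gcongr, ?_, ?_⟩
  · rw [div_le_div_iff₀ hNp hMpos]
    nlinarith
  · have hlogN := (hN₀ N hNj).2.2.2.2.1
    calc _ ≤ 8 / 7 * (C₂ + C₁) * (N * Real.log N ^ d) := by linarith
      _ ≤ _ := by gcongr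

/-! ### From energy to discrepancy. -/

lemma abs_prod_sub_prod_le {ι : Type*} (s : Finset ι) {a b : ι → ℝ} {B : ℝ} (hB : 1 ≤ B)
    (ha : ∀ i ∈ s, |a i| ≤ B) (hb : ∀ i ∈ s, |b i| ≤ B) :
    |∏ i ∈ s, a i - ∏ i ∈ s, b i| ≤ B ^ s.card * ∑ i ∈ s, |a i - b i| := by
  classical
  induction s using Finset.induction_on with
  | empty => simp
  | insert k s hk ih =>
    have ih' := ih (fun i hi => ha i (by simp [hi])) fun i hi => hb i (by simp [hi])
    rw [Finset.prod_insert hk, Finset.prod_insert hk, Finset.sum_insert hk,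
      Finset.card_insert_of_notMem hk]
    have hA : |∏ i ∈ s, a i| ≤ B ^ s.card := by
      rw [Finset.abs_prod]
      refine (Finset.prod_le_prod (fun i _ => abs_nonneg _)
        fun i hi => ha i (by simp [hi])).trans_eq ?_
      rw [Finset.prod_const]
    have hbk := hb k (by simp)
    have e : a k * ∏ i ∈ s, a i - b k * ∏ i ∈ s, b i
        = (a k - b k) * ∏ i ∈ s, a i + b k * (∏ i ∈ s, a i - ∏ i ∈ s, b i) := by ring
    rw [e]
    refine (abs_add_le _ _).trans ?_
    rw [abs_mul, abs_mul]
    have hBs : 0 ≤ B ^ s.card := by positivity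
    have h1 : |a k - b k| * |∏ i ∈ s, a i| ≤ |a k - b k| * B ^ (s.card + 1) := by
      gcongr
      exact hA.trans (pow_le_pow_right₀ hB (Nat.le_succ _))
    have h2 : |b k| * |∏ i ∈ s, a i - ∏ i ∈ s, b i| ≤ B * (B ^ s.card * ∑ i ∈ s, |a i - b i|) :=
      mul_le_mul hbk ih' (abs_nonneg _) (by linarith)
    calc _ ≤ |a k - b k| * B ^ (s.card + 1) + B * (B ^ s.card * ∑ i ∈ s, |a i - b i|) :=
          add_le_add h1 h2
      _ = _ := by ring

namespace IsPSDKernel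

lemma prod_sub_prod {ι : Type*} (s : Finset ι) {F G : ι → ℕ → ℕ → ℝ}
    (hF : ∀ i ∈ s, IsPSDKernel (F i)) (hG : ∀ i ∈ s, IsPSDKernel (G i))
    (h : ∀ i ∈ s, IsPSDKernel (fun m n => G i m n - F i m n)) :
    IsPSDKernel (fun m n => ∏ i ∈ s, G i m n - ∏ i ∈ s, F i m n) := by
  classical
  induction s using Finset.induction_on with
  | empty => simpa using const le_rfl
  | insert a s ha ih =>
    simp only [Finset.prod_insert ha]
    exact mul_sub_mul (hF a (by simp)) (prod s fun i hi => hG i (by simp [hi])) (h a (by simp))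
      (ih (fun i hi => hF i (by simp [hi])) (fun i hi => hG i (by simp [hi]))
        fun i hi => h i (by simp [hi]))

end IsPSDKernel

/-- The indicator function of `[0, y]`, smoothed at scale `1 - r`. -/
noncomputable def smoothInd (r y t : ℝ) : ℝ := y + smoothSaw r (t - y) - smoothSaw r t

/-- The sawtooth expression is the indicator except possibly at the jumps `t = y` and `t = 1`. There
it errs by at most `1`, which is covered by `σ` being `1` at the integers. -/
lemma abs_indicator_sub_sawtooth_le {t y : ℝ} (ht0 : 0 ≤ t) (ht1 : t ≤ 1) (hy0 : 0 ≤ y)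
    (hy1 : y ≤ 1) {σ : ℝ → ℝ} (hσ : ∀ z, 0 ≤ σ z) (hσ1 : ∀ k : ℤ, σ k = 1) :
    |(if t ≤ y then 1 else 0) - (y + sawtooth (t - y) - sawtooth t)| ≤ σ (t - y) + σ t := by
  have hv : y + sawtooth (t - y) - sawtooth t = ((⌊t⌋ - ⌊t - y⌋ : ℤ) : ℝ) := by
    unfold sawtooth Int.fract
    push_cast
    ring
  rw [hv]
  have h1 := hσ (t - y)
  have h2 := hσ t
  rcases ht1.lt_or_eq with ht | ht
  · have hft : ⌊t⌋ = 0 := Int.floor_eq_zero_iff.2 ⟨ht0, ht⟩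
    rw [hft, zero_sub]
    rcases lt_or_ge t y with h | h
    · have : ⌊t - y⌋ = -1 := by
        rw [Int.floor_eq_iff]; push_cast; constructor <;> linarith
      rw [this, if_pos h.le]
      push_cast
      norm_num
      linarith
    · have : ⌊t - y⌋ = 0 := Int.floor_eq_zero_iff.2 ⟨by linarith, by linarith⟩
      rw [this]
      rcases h.lt_or_eq with h' | h'
      · rw [if_neg (not_le.2 h')]
        simp
        linarith
      · rw [if_pos h'.ge, ← h', sub_self]
        have := hσ1 0
        rw [Int.cast_zero] at this
        rw [this]
        norm_num
        rwa [h']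
  · have hs : σ t = 1 := by rw [ht]; simpa using hσ1 1
    have hft : ⌊t⌋ = 1 := by rw [ht]; exact Int.floor_one
    rw [hft, hs]
    rcases hy0.lt_or_eq with h | h
    · have : ⌊t - y⌋ = 0 := Int.floor_eq_zero_iff.2 ⟨by linarith, by linarith⟩
      rw [this]
      split_ifs <;> norm_num <;> linarith
    · have : ⌊t - y⌋ = 1 := by rw [← h, sub_zero, hft]
      rw [this]
      split_ifs <;> norm_num <;> linarith

lemma chordSq_intCast (k : ℤ) : chordSq k = 0 := by
  rw [chordSq_eq, mul_comm Real.pi, Real.sin_int_mul_pi]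
  ring

lemma abs_indicator_sub_smoothInd_le {r : ℝ} (h0 : 0 < r) (h1 : r < 1) {t y : ℝ} (ht0 : 0 ≤ t)
    (ht1 : t ≤ 1) (hy0 : 0 ≤ y) (hy1 : y ≤ 1) :
    |(if t ≤ y then 1 else 0) - smoothInd r y t|
      ≤ 6 * ((1 - r) ^ 2 / poissonDen r (t - y) + (1 - r) ^ 2 / poissonDen r t) := by
  have ha := abs_indicator_sub_sawtooth_le ht0 ht1 hy0 hy1
    (σ := fun z => (1 - r) ^ 2 / poissonDen r z)
    (fun z => div_nonneg (sq_nonneg _) (poissonDen_pos h0.le h1 z).le) (fun k => by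
      have : (1 - r) ^ 2 ≠ 0 := pow_ne_zero 2 (by linarith)
      rw [poissonDen, chordSq_intCast, mul_zero, add_zero, div_self this])
  have h2 := abs_sawtooth_sub_smoothSaw_le h0 h1 (t - y)
  have h3 := abs_sawtooth_sub_smoothSaw_le h0 h1 t
  rw [abs_le] at *
  unfold smoothInd
  constructor <;> linarith [ha.1, ha.2, h2.1, h2.2, h3.1, h3.2]

section points

variable {d : ℕ} {q ε : ℝ}

/-- Expanding `boxKernel - 1` gives all nonempty products of the one-dimensional kernels; those on
the right are some of them. The factor of coordinate `j` without the `1` is what removes the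
constant term. -/
lemma mixKernel_le_boxKernel (hq : 0 < q) (hq1 : q < 1) (hε : 0 < ε) (hε1 : ε ≤ 1)
    (x : ℕ → Fin d → ℝ) {j : Fin d} {s : Finset (Fin d)} (hj : j ∉ s) :
    IsPSDKernel (fun m n => (boxKernel q ε x m n - 1)
      - mixKernel q ε (x m j - x n j) * ∏ i ∈ s, (1 + mixKernel q ε (x m i - x n i))) := by
  have hH : ∀ i : Fin d, IsPSDKernel (fun m n => mixKernel q ε (x m i - x n i)) := fun i =>
    isPSDKernel_mixKernel hq hq1 hε hε1 fun n => x n i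
  have hP : ∀ s : Finset (Fin d), IsPSDKernel (fun m n =>
      ∏ i ∈ s, (1 + mixKernel q ε (x m i - x n i))) := fun s =>
    IsPSDKernel.prod s fun i _ => (IsPSDKernel.const zero_le_one).add (hH i)
  have h1 := IsPSDKernel.prod_one_add_sub_one s fun i _ => hH i
  have h2 := (IsPSDKernel.prod_one_add_sub_one (insert j s)ᶜ fun i _ => hH i).mul (hP (insert j s))
  refine (h1.add h2).congr fun m n => ?_
  have e : boxKernel q ε x m n = (∏ i ∈ (insert j s)ᶜ, (1 + mixKernel q ε (x m i - x n i))) *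
      ∏ i ∈ insert j s, (1 + mixKernel q ε (x m i - x n i)) :=
    (Finset.prod_compl_mul_prod _ _).symm
  rw [e, Finset.prod_insert hj]
  ring

/-- Sums of the Poisson kernel over a coordinate of the points. -/
lemma sum_poissonKer_le (hq : 0 < q) (hq1 : q < 1) (hε : 0 < ε) (hε1 : ε ≤ 1 / 2)
    (x : ℕ → Fin d → ℝ) (M : ℕ) (j : Fin d) (α : ℝ) :
    ε * ∑ n ∈ Finset.Icc 1 M, poissonKer (1 - ε) (x n j - α)
      ≤ ε * M + 2 * √(energyExcess q ε x M / (1 - q)) := by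
  have hp : 0 < 1 - q := by linarith
  have h1 := poissonKer_rankOne_le (r := 1 - ε) (by linarith) (by linarith) α fun n => x n j
  rw [sub_sub_cancel] at h1
  have h2 := logKernel_le_mixKernel hq hq1 hε (by linarith) fun n => x n j
  have h3 := mixKernel_le_boxKernel hq hq1 hε (by linarith) x (Finset.notMem_empty j)
  simp only [Finset.prod_empty, mul_one] at h3
  have h4 : IsPSDKernel (fun m n => 4 * (1 / ε ^ 2) / (1 - q) * (boxKernel q ε x m n - 1)
      - (poissonKer (1 - ε) (x m j - α) - 1) * (poissonKer (1 - ε) (x n j - α) - 1)) := by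
    -- Raises the constant `4 (1 - ε) / ε²` to `4 / ε²`.
    have h5 := (isPSDKernel_logKernel (r := 1 - ε) (by linarith) (by linarith)
      fun n => x n j).const_mul (a := 4 * (ε / ε ^ 2)) (by positivity)
    refine (((h1.add h5).add (h2.const_mul (a := 4 * (1 / ε ^ 2) / (1 - q)) (by positivity))).add
      (h3.const_mul (a := 4 * (1 / ε ^ 2) / (1 - q)) (by positivity))).congr fun m n => ?_
    field_simp
    ring
  have h6 := h4.sq_sum_le (Finset.Icc 1 M)
  simp only [← Finset.mul_sum] at h6
  change _ ≤ 4 * (1 / ε ^ 2) / (1 - q) * energyExcess q ε x M at h6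
  have hA := energyExcess_nonneg hq hq1 hε (by linarith) x M
  have h7 : (ε * ∑ n ∈ Finset.Icc 1 M, (poissonKer (1 - ε) (x n j - α) - 1)) ^ 2
      ≤ (2 * √(energyExcess q ε x M / (1 - q))) ^ 2 := by
    rw [mul_pow, mul_pow, Real.sq_sqrt (by positivity)]
    calc _ ≤ ε ^ 2 * (4 * (1 / ε ^ 2) / (1 - q) * energyExcess q ε x M) := by gcongr
      _ = _ := by field_simp; ring
  have h8 := (le_abs_self _).trans (abs_le_of_sq_le_sq h7 (by positivity))
  rw [Finset.sum_sub_distrib] at h8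
  simp only [Finset.sum_const, Nat.card_Icc, add_tsub_cancel_right, nsmul_eq_mul, mul_one] at h8
  linarith

/-- The square norm of the smoothed indicators in the reproducing kernel space. -/
noncomputable def indNorm (q ε : ℝ) : ℝ :=
  2 * (1 + 4 * (-Real.log ε + 3 / (1 - ε)) / (1 - q))

/-- Both forms are needed in the telescoping over coordinates: the centred one for the coordinate
being exchanged, and the full one, against `1 + mixKernel`, for the coordinates still smoothed. -/
lemma smoothInd_rankOne_le (hq : 0 < q) (hq1 : q < 1) (hε : 0 < ε) (hε1 : ε ≤ 1 / 2) {y : ℝ}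
    (hy0 : 0 ≤ y) (hy1 : y ≤ 1) (t : ℕ → ℝ) :
    IsPSDKernel (fun m n => indNorm q ε * mixKernel q ε (t m - t n)
      - (smoothInd (1 - ε) y (t m) - y) * (smoothInd (1 - ε) y (t n) - y)) ∧
    IsPSDKernel (fun m n => indNorm q ε * (1 + mixKernel q ε (t m - t n))
      - smoothInd (1 - ε) y (t m) * smoothInd (1 - ε) y (t n)) := by
  have hp : 0 < 1 - q := by linarith
  have hlog : Real.log ε ≤ 0 := Real.log_nonpos hε.le (by linarith)
  have hr : 0 < 1 - ε := by linarith
  obtain ⟨R₀, hR₀⟩ : ∃ R, R = -Real.log ε + 3 / (1 - ε) := ⟨_, rfl⟩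
  have hR₀0 : 0 ≤ R₀ := by
    rw [hR₀]
    have : 0 < 3 / (1 - ε) := by positivity
    linarith
  have hmix := isPSDKernel_mixKernel hq hq1 hε (by linarith) t
  have h1 := smoothSaw_rankOne_le hr (by linarith) y t
  have h2 := smoothSaw_rankOne_le hr (by linarith) 0 t
  rw [sub_sub_cancel, ← hR₀] at h1 h2
  have h3 := (h1.add_mul_add_le (g := fun n => -smoothSaw (1 - ε) (t n - 0))
    (h2.congr fun m n => by rw [neg_mul_neg]))
  have h4 := (logKernel_le_mixKernel hq hq1 hε (by linarith) t).const_mul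
    (a := 2 * (R₀ + R₀) / (1 - q)) (by positivity)
  have hv : IsPSDKernel (fun m n => 4 * R₀ / (1 - q) * mixKernel q ε (t m - t n)
      - (smoothInd (1 - ε) y (t m) - y) * (smoothInd (1 - ε) y (t n) - y)) := by
    refine (h3.add h4).congr fun m n => ?_
    unfold smoothInd
    rw [sub_zero, sub_zero]
    field_simp
    ring
  have hR : indNorm q ε = 2 * (1 + 4 * R₀ / (1 - q)) := by rw [indNorm, hR₀]
  have hR1 : 0 ≤ 4 * R₀ / (1 - q) := by positivity
  rw [hR]
  constructor
  · refine (hv.add (hmix.const_mul (a := 2 + 4 * R₀ / (1 - q)) (by linarith))).congr fun m n => ?_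
    ring
  · have h5 : IsPSDKernel (fun m n => 4 * R₀ / (1 - q) * (1 + mixKernel q ε (t m - t n))
      - (smoothInd (1 - ε) y (t m) - y) * (smoothInd (1 - ε) y (t n) - y)) :=
      (hv.add (IsPSDKernel.const hR1)).congr fun m n => by ring
    have h6 : IsPSDKernel (fun m n => 1 * (1 + mixKernel q ε (t m - t n)) - y * y) :=
      (hmix.add (IsPSDKernel.const (by nlinarith : 0 ≤ 1 - y * y))).congr fun m n => by ring
    refine (h6.add_mul_add_le (f := fun _ => y) h5).congr fun m n => ?_
    ring

lemma two_le_indNorm (hq1 : q < 1) (hε : 0 < ε) (hε1 : ε ≤ 1 / 2) : 2 ≤ indNorm q ε := by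
  have hp : 0 < 1 - q := by linarith
  have hlog : Real.log ε ≤ 0 := Real.log_nonpos hε.le (by linarith)
  have hr : 0 < 1 - ε := by linarith
  have : 0 ≤ -Real.log ε + 3 / (1 - ε) := by
    have : 0 < 3 / (1 - ε) := by positivity
    linarith
  have : 0 ≤ 4 * (-Real.log ε + 3 / (1 - ε)) / (1 - q) := by positivity
  unfold indNorm
  linarith

/-- Quadrature error of a product of smoothed indicators. -/
lemma abs_sum_prod_smoothInd_sub_le (hq : 0 < q) (hq1 : q < 1) (hε : 0 < ε) (hε1 : ε ≤ 1 / 2)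
    (x : ℕ → Fin d → ℝ) (M : ℕ) {y : Fin d → ℝ} (hy0 : ∀ i, 0 ≤ y i) (hy1 : ∀ i, y i ≤ 1)
    (s : Finset (Fin d)) :
    |∑ n ∈ Finset.Icc 1 M, (∏ i ∈ s, smoothInd (1 - ε) (y i) (x n i) - ∏ i ∈ s, y i)|
      ≤ s.card * √(indNorm q ε ^ d * energyExcess q ε x M) := by
  have hR := two_le_indNorm hq1 hε hε1
  have hR0 : 0 ≤ indNorm q ε := by linarith
  have hA := energyExcess_nonneg hq hq1 hε (by linarith) x M
  induction s using Finset.induction_on with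
  | empty => simp
  | insert k s hk ih =>
    -- Telescoping over coordinates: the first summand has a centred factor, so it is controlled by
    -- `boxKernel - 1`, without the mean.
    have e : ∑ n ∈ Finset.Icc 1 M, (∏ i ∈ insert k s, smoothInd (1 - ε) (y i) (x n i)
        - ∏ i ∈ insert k s, y i)
        = ∑ n ∈ Finset.Icc 1 M, (smoothInd (1 - ε) (y k) (x n k) - y k) *
          ∏ i ∈ s, smoothInd (1 - ε) (y i) (x n i)
        + y k * ∑ n ∈ Finset.Icc 1 M,
          (∏ i ∈ s, smoothInd (1 - ε) (y i) (x n i) - ∏ i ∈ s, y i) := by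
      rw [Finset.mul_sum, ← Finset.sum_add_distrib]
      refine Finset.sum_congr rfl fun n _ => ?_
      rw [Finset.prod_insert hk, Finset.prod_insert hk]
      ring
    have hH : ∀ i : Fin d, IsPSDKernel (fun m n => mixKernel q ε (x m i - x n i)) := fun i =>
      isPSDKernel_mixKernel hq hq1 hε (by linarith) fun n => x n i
    have hG : ∀ i ∈ s, IsPSDKernel
        (fun m n => indNorm q ε * (1 + mixKernel q ε (x m i - x n i))) := fun i _ =>
      ((IsPSDKernel.const zero_le_one).add (hH i)).const_mul hR0
    have h1 := IsPSDKernel.prod_sub_prod s (fun i _ => IsPSDKernel.rankOne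
      fun n => smoothInd (1 - ε) (y i) (x n i)) hG
      fun i _ => (smoothInd_rankOne_le hq hq1 hε hε1 (hy0 i) (hy1 i) fun n => x n i).2
    have h2 := IsPSDKernel.mul_sub_mul (IsPSDKernel.rankOne
      fun n => smoothInd (1 - ε) (y k) (x n k) - y k) (IsPSDKernel.prod s hG)
      (smoothInd_rankOne_le hq hq1 hε hε1 (hy0 k) (hy1 k) fun n => x n k).1 h1
    have h3 := (mixKernel_le_boxKernel hq hq1 hε (by linarith) x hk).const_mul
      (a := indNorm q ε ^ (s.card + 1)) (by positivity)
    have hcard : s.card + 1 ≤ d := by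
      have := Finset.card_le_univ (insert k s)
      rwa [Finset.card_insert_of_notMem hk, Fintype.card_fin] at this
    have hpow : indNorm q ε ^ (s.card + 1) ≤ indNorm q ε ^ d :=
      pow_le_pow_right₀ (by linarith) hcard
    have h4 := (isPSDKernel_boxKernel_sub_one hq hq1 hε (by linarith) x).const_mul
      (sub_nonneg.2 hpow)
    have h5 : IsPSDKernel (fun m n => indNorm q ε ^ d * (boxKernel q ε x m n - 1)
        - ((smoothInd (1 - ε) (y k) (x m k) - y k) * ∏ i ∈ s, smoothInd (1 - ε) (y i) (x m i))
        * ((smoothInd (1 - ε) (y k) (x n k) - y k) *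
          ∏ i ∈ s, smoothInd (1 - ε) (y i) (x n i))) := by
      refine ((h2.add h3).add h4).congr fun m n => ?_
      rw [Finset.prod_mul_distrib, Finset.prod_mul_distrib, Finset.prod_const]
      ring
    have h6 := h5.sq_sum_le (Finset.Icc 1 M)
    simp only [← Finset.mul_sum] at h6
    change _ ≤ indNorm q ε ^ d * energyExcess q ε x M at h6
    have h7 := Real.abs_le_sqrt h6
    rw [e, Finset.card_insert_of_notMem hk]
    refine (abs_add_le _ _).trans ?_
    rw [abs_mul, abs_of_nonneg (hy0 k)]
    have h8 := mul_le_of_le_one_left (abs_nonneg (∑ n ∈ Finset.Icc 1 M,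
          (∏ i ∈ s, smoothInd (1 - ε) (y i) (x n i) - ∏ i ∈ s, y i))) (hy1 k)
    push_cast
    linarith

/-- An Erdős–Turán type inequality: the local discrepancy is controlled by the energy. -/
lemma abs_count_sub_le (hq : 0 < q) (hq1 : q < 1) (hε : 0 < ε) (hε1 : ε ≤ 1 / 2)
    {x : ℕ → Fin d → ℝ} (hx : ∀ n, 1 ≤ n → ∀ j, 0 ≤ x n j ∧ x n j ≤ 1) (M : ℕ) {y : Fin d → ℝ}
    (hy0 : ∀ i, 0 ≤ y i) (hy1 : ∀ i, y i ≤ 1) :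
    |∑ n ∈ Finset.Icc 1 M, ((∏ i, if x n i ≤ y i then (1 : ℝ) else 0) - ∏ i, y i)|
      ≤ d * √(indNorm q ε ^ d * energyExcess q ε x M)
        + 13 ^ d * (d * (12 * (ε * M + 2 * √(energyExcess q ε x M / (1 - q))))) := by
  have hσ : ∀ z, (1 - (1 - ε)) ^ 2 / poissonDen (1 - ε) z ≤ ε * poissonKer (1 - ε) z ∧
      (1 - (1 - ε)) ^ 2 / poissonDen (1 - ε) z ≤ 1 := by
    intro z
    have hd := poissonDen_pos (r := 1 - ε) (by linarith) (by linarith) z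
    constructor
    · rw [poissonKer, mul_div_assoc']
      gcongr
      nlinarith
    · exact (div_le_one hd).2 (sq_le_poissonDen (by linarith) z)
  have hterm : ∀ n ∈ Finset.Icc 1 M, |(∏ i, if x n i ≤ y i then (1 : ℝ) else 0)
      - ∏ i, smoothInd (1 - ε) (y i) (x n i)| ≤ 13 ^ d * ∑ i, 6 *
        (ε * poissonKer (1 - ε) (x n i - y i) + ε * poissonKer (1 - ε) (x n i - 0)) := by
    intro n hn
    rw [Finset.mem_Icc] at hn
    have hi : ∀ i, |(if x n i ≤ y i then (1 : ℝ) else 0) - smoothInd (1 - ε) (y i) (x n i)|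
        ≤ 6 * ((1 - (1 - ε)) ^ 2 / poissonDen (1 - ε) (x n i - y i)
          + (1 - (1 - ε)) ^ 2 / poissonDen (1 - ε) (x n i)) := fun i =>
      abs_indicator_sub_smoothInd_le (by linarith) (by linarith) (hx n hn.1 i).1 (hx n hn.1 i).2
        (hy0 i) (hy1 i)
    have hone : ∀ i, |(if x n i ≤ y i then (1 : ℝ) else 0)| ≤ 1 := fun i => by
      split_ifs <;> simp
    -- The indicator is at most `1` and the smoothing error at most `6 (1 + 1) = 12`, hence `13`.
    have h := abs_prod_sub_prod_le (Finset.univ : Finset (Fin d)) (B := 13) (by norm_num)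
      (a := fun i => if x n i ≤ y i then (1 : ℝ) else 0)
      (b := fun i => smoothInd (1 - ε) (y i) (x n i))
      (fun i _ => (hone i).trans (by norm_num)) (fun i _ => by
        have h1 := abs_le.1 (hi i)
        have h2 := (hσ (x n i - y i)).2
        have h3 := (hσ (x n i)).2
        have h4 := abs_le.1 (hone i)
        rw [abs_le]
        constructor <;> linarith [h1.1, h1.2, h4.1, h4.2])
    rw [Finset.card_univ, Fintype.card_fin] at h
    refine h.trans (mul_le_mul_of_nonneg_left (Finset.sum_le_sum fun i _ => (hi i).trans ?_)
      (by positivity))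
    rw [sub_zero]
    linarith [(hσ (x n i - y i)).1, (hσ (x n i)).1]
  have hsum : ∑ n ∈ Finset.Icc 1 M, 13 ^ d * ∑ i : Fin d, 6 *
        (ε * poissonKer (1 - ε) (x n i - y i) + ε * poissonKer (1 - ε) (x n i - 0))
      ≤ 13 ^ d * (d * (12 * (ε * M + 2 * √(energyExcess q ε x M / (1 - q))))) := by
    rw [← Finset.mul_sum, Finset.sum_comm]
    refine mul_le_mul_of_nonneg_left ?_ (by positivity)
    have : ∀ i : Fin d, ∑ n ∈ Finset.Icc 1 M, 6 *
        (ε * poissonKer (1 - ε) (x n i - y i) + ε * poissonKer (1 - ε) (x n i - 0))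
        ≤ 12 * (ε * M + 2 * √(energyExcess q ε x M / (1 - q))) := by
      intro i
      rw [← Finset.mul_sum, Finset.sum_add_distrib, ← Finset.mul_sum, ← Finset.mul_sum]
      linarith [sum_poissonKer_le hq hq1 hε hε1 x M i (y i),
        sum_poissonKer_le hq hq1 hε hε1 x M i 0]
    refine (Finset.sum_le_sum fun i _ => this i).trans_eq ?_
    simp
  have hmain := abs_sum_prod_smoothInd_sub_le hq hq1 hε hε1 x M hy0 hy1 Finset.univ
  rw [Finset.card_univ, Fintype.card_fin] at hmain
  have e : ∑ n ∈ Finset.Icc 1 M, ((∏ i, if x n i ≤ y i then (1 : ℝ) else 0) - ∏ i, y i)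
      = ∑ n ∈ Finset.Icc 1 M, (∏ i, smoothInd (1 - ε) (y i) (x n i) - ∏ i, y i)
        + ∑ n ∈ Finset.Icc 1 M, ((∏ i, if x n i ≤ y i then (1 : ℝ) else 0)
          - ∏ i, smoothInd (1 - ε) (y i) (x n i)) := by
    rw [← Finset.sum_add_distrib]
    exact Finset.sum_congr rfl fun n _ => by ring
  rw [e]
  refine (abs_add_le _ _).trans (add_le_add hmain ?_)
  exact (Finset.abs_sum_le_sum_abs _ _).trans ((Finset.sum_le_sum hterm).trans hsum)

end points

/-! ### The discrepancy bound. -/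

lemma starDiscrepancy_le_of_forall {d : ℕ} {x : ℕ → Fin d → ℝ} {M : ℕ} (hM : 0 < M) {B : ℝ}
    (h : ∀ y : Fin d → ℝ, (∀ i, 0 ≤ y i) → (∀ i, y i ≤ 1) →
      |∑ n ∈ Finset.Icc 1 M, ((∏ i, if x n i ≤ y i then (1 : ℝ) else 0) - ∏ i, y i)| ≤ B) :
    starDiscrepancy x M ≤ B / M := by
  classical
  have hM' : (0 : ℝ) < M := by exact_mod_cast hM
  have : Nonempty (Set.Icc (0 : Fin d → ℝ) 1) := ⟨⟨0, by simp⟩⟩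
  refine ciSup_le fun y => ?_
  have hy := h y.1 (fun i => y.2.1 i) (fun i => y.2.2 i)
  have e : ∑ n ∈ Finset.Icc 1 M, ((∏ i, if x n i ≤ y.1 i then (1 : ℝ) else 0) - ∏ i, y.1 i)
      = (((Finset.Icc 1 M).filter fun n => ∀ i, x n i ≤ y.1 i).card : ℝ) - M * ∏ i, y.1 i := by
    rw [Finset.sum_sub_distrib, Finset.natCast_card_filter]
    simp [Finset.prod_boole]
  rw [e] at hy
  rw [le_div_iff₀ hM', ← abs_of_pos hM', ← abs_mul, abs_of_pos hM', sub_mul,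
    div_mul_cancel₀ _ hM'.ne', mul_comm (∏ i, y.1 i)]
  convert hy using 4

lemma starDiscrepancy_le_one {d : ℕ} (x : ℕ → Fin d → ℝ) {M : ℕ} (hM : 0 < M) :
    starDiscrepancy x M ≤ 1 := by
  have hM' : (0 : ℝ) < M := by exact_mod_cast hM
  refine (starDiscrepancy_le_of_forall (x := x) hM (B := M) fun y hy0 hy1 => ?_).trans_eq
    (div_self hM'.ne')
  refine (Finset.abs_sum_le_sum_abs _ _).trans ?_
  have : ∀ n ∈ Finset.Icc 1 M,
      |(∏ i, if x n i ≤ y i then (1 : ℝ) else 0) - ∏ i, y i| ≤ 1 := by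
    intro n _
    have h1 : 0 ≤ ∏ i, y i := Finset.prod_nonneg fun i _ => hy0 i
    have h2 : ∏ i, y i ≤ 1 := Finset.prod_le_one (fun i _ => hy0 i) fun i _ => hy1 i
    rw [Finset.prod_boole, abs_le]
    split_ifs <;> constructor <;> linarith
  refine (Finset.sum_le_sum this).trans_eq ?_
  simp

theorem theorem3 (d : ℕ) (hd : 1 ≤ d) (m : ℕ) (a : Fin m → Fin d → ℝ)
    (ha : ∀ i j, 0 ≤ a i j ∧ a i j ≤ 1) :
    ∃ C : ℝ, 0 < C ∧ ∀ x : ℕ → Fin d → ℝ, IsGreedySequence a x → ∀ N : ℕ, 2 ≤ N →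
      starDiscrepancy x N ≤ C * (Real.log (N : ℝ) ^ d / Real.sqrt (N : ℝ)) := by
  obtain ⟨q, K, C, N₀, hq, hq1, hK1, hC, hN₀, hE⟩ := exists_energyExcess_le hd m
  have hp : 0 < 1 - q := by linarith
  have hd0 : (0 : ℝ) ≤ d := Nat.cast_nonneg d
  set C₁ : ℝ := d * √((42 / (1 - q)) ^ d * C) + 13 ^ d * (d * (12 * (2 * K + 2 * √(C / (1 - q)))))
    with hC₁
  have hC₁0 : 0 ≤ C₁ := by positivity
  have hl2 : 0 < Real.log 2 := Real.log_pos one_lt_two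
  have hN₀pos : (0 : ℝ) < N₀ := by linarith
  -- The second summand makes the right side at least `1` for `2 ≤ N < N₀`, where only the trivial
  -- bound on the discrepancy is available.
  refine ⟨C₁ + √N₀ / Real.log 2 ^ d, by positivity, fun x hx N hN => ?_⟩
  have hN' : (2 : ℝ) ≤ N := by exact_mod_cast hN
  have hNpos : (0 : ℝ) < N := by linarith
  have hsq : 0 < √(N : ℝ) := Real.sqrt_pos.2 hNpos
  have hlog2 : Real.log 2 ≤ Real.log N := Real.log_le_log two_pos hN'
  have hfrac : 0 ≤ Real.log N ^ d / √N := by positivity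
  rw [add_mul]
  rcases lt_or_ge N N₀ with hlt | hge
  · refine (starDiscrepancy_le_one x (by omega)).trans ?_
    have h1 : 1 ≤ √N₀ / Real.log 2 ^ d * (Real.log N ^ d / √N) := by
      rw [div_mul_div_comm, one_le_div (by positivity), mul_comm]
      have : √(N : ℝ) ≤ √N₀ := Real.sqrt_le_sqrt (by exact_mod_cast hlt.le)
      gcongr
    have := mul_nonneg hC₁0 hfrac
    linarith
  · obtain ⟨ε, hε0, hε1, hA⟩ := hE x hx.rule N hge
    have hge' : (N₀ : ℝ) ≤ N := by exact_mod_cast hge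
    have hε : 0 < ε := lt_of_lt_of_le (by positivity) hε0
    have hε5 : ε ≤ 1 / 5 := by
      refine hε1.trans ?_
      rw [div_le_iff₀ hNpos]
      linarith
    have hL : 1 ≤ Real.log N := by
      rw [Real.le_log_iff_exp_le hNpos]
      have := Real.exp_one_lt_d9
      linarith
    set L := Real.log N with hLdef
    have hLd : 1 ≤ L ^ d := one_le_pow₀ hL
    have hbd := starDiscrepancy_le_of_forall (by omega) fun y hy0 hy1 =>
      abs_count_sub_le hq hq1 hε (by linarith) hx.mem_cube N hy0 hy1
    refine hbd.trans ?_
    have hAnn := energyExcess_nonneg hq hq1 hε (by linarith) x N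
    set A := energyExcess q ε x N
    have hR : indNorm q ε ≤ 42 / (1 - q) * L := by
      have h1 : -Real.log ε ≤ L := by
        rw [← Real.log_inv]
        apply Real.log_le_log (by positivity)
        rw [inv_le_comm₀ hε hNpos, inv_eq_one_div]
        exact le_trans (by gcongr) hε0
      have h2 : 3 / (1 - ε) ≤ 15 / 4 := by
        rw [div_le_iff₀ (by linarith)]; linarith
      have h3 : -Real.log ε + 3 / (1 - ε) ≤ 5 * L := by linarith
      have h4 : 4 * (-Real.log ε + 3 / (1 - ε)) / (1 - q) ≤ 4 * (5 * L) / (1 - q) := by gcongr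
      have h5 : 1 ≤ L / (1 - q) := by rw [one_le_div hp]; linarith
      have e : 42 / (1 - q) * L = 2 * (L / (1 - q) + 4 * (5 * L) / (1 - q)) := by ring
      rw [e, indNorm]
      linarith
    have hR0 := two_le_indNorm hq1 hε (by linarith)
    have hsqrt : ∀ c : ℝ, 0 ≤ c → √(c * (N * (L ^ d) ^ 2)) = √c * (√N * L ^ d) := fun c hc => by
      rw [Real.sqrt_mul hc, Real.sqrt_mul hNpos.le, Real.sqrt_sq (by positivity)]
    -- The dominant term: one factor `L ^ d` comes from the norm of the smoothed box and one from
    -- the energy, and the root of their product is `L ^ d`.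
    have hs1 : √(indNorm q ε ^ d * A) ≤ √((42 / (1 - q)) ^ d * C) * (√N * L ^ d) := by
      have e : √((42 / (1 - q)) ^ d * C) * (√N * L ^ d)
          = √((42 / (1 - q) * L) ^ d * (C * (N * L ^ d))) := by
        have : (42 / (1 - q) * L) ^ d * (C * (N * L ^ d))
            = ((42 / (1 - q)) ^ d * C) * (N * (L ^ d) ^ 2) := by rw [mul_pow]; ring
        rw [this, hsqrt _ (by positivity)]
      rw [e]
      apply Real.sqrt_le_sqrt
      gcongr
    have hs2 : √(A / (1 - q)) ≤ √(C / (1 - q)) * (√N * L ^ d) := by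
      have e : √(C / (1 - q)) * (√N * L ^ d) = √((C * (N * (L ^ d * L ^ d))) / (1 - q)) := by
        have : C * (N * (L ^ d * L ^ d)) / (1 - q) = C / (1 - q) * (N * (L ^ d) ^ 2) := by ring
        rw [this, hsqrt _ (by positivity)]
      rw [e]
      apply Real.sqrt_le_sqrt
      gcongr
      refine hA.trans ?_
      gcongr
      exact le_mul_of_one_le_left (by positivity) hLd
    have hs3 : ε * N ≤ 2 * K * (√N * L ^ d) := by
      rw [le_div_iff₀ hNpos] at hε1
      have h1 : 1 ≤ √(N : ℝ) := Real.one_le_sqrt.2 (by linarith)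
      have h2 : 1 ≤ √(N : ℝ) * L ^ d := one_le_mul_of_one_le_of_one_le h1 hLd
      nlinarith
    have htot : d * √(indNorm q ε ^ d * A) + 13 ^ d * (d * (12 * (ε * N + 2 * √(A / (1 - q)))))
        ≤ C₁ * (√N * L ^ d) := by
      calc _ ≤ d * (√((42 / (1 - q)) ^ d * C) * (√N * L ^ d)) + 13 ^ d * (d * (12 *
            (2 * K * (√N * L ^ d) + 2 * (√(C / (1 - q)) * (√N * L ^ d))))) := by gcongr
        _ = _ := by rw [hC₁]; ring
    have hfin : C₁ * (√N * L ^ d) / N = C₁ * (L ^ d / √N) := by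
      have hNs : (N : ℝ) = √N * √N := (Real.mul_self_sqrt hNpos.le).symm
      rw [mul_div_assoc]
      congr 1
      rw [div_eq_div_iff hNpos.ne' hsq.ne']
      calc _ = L ^ d * (√N * √N) := by ring
        _ = _ := by rw [← hNs]
    have h1 : 0 ≤ √N₀ / Real.log 2 ^ d * (L ^ d / √N) := by positivity
    calc _ ≤ C₁ * (√N * L ^ d) / N := by gcongr
      _ = C₁ * (L ^ d / √N) := hfin
      _ ≤ _ := by linarith
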